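/- Notation. For a two-qubit operator $X$ let $F(X)=\max_{\phi}\langle\phi|X|\phi\rangle$, the maximum over all maximally entangled two-qubit vectors $\phi$, and for a two-qubit state $\rho$ of Alice and Bob let $F^\star(\rho)=\max_\Lambda F(\Lambda(\rho))$, the maximum over all trace-preserving (finite-round) LOCC protocols $\Lambda$ with two-qubit output. Let $(u_0,u_1)$, $(v_0,v_1)$, $(w_0,w_1)$, $(z_0,z_1)$ be arbitrary orthonormal bases of, respectively, Alice's qubit, the node's qubit in segment $S_1$, the node's qubit in segment $S_2$, and Bob's qubit (for instance all equal to the computational basis $|0\rangle,|1\rangle$). Let $p\in[0,1]$ and $\delta,\alpha,\beta\in[1/2,1)$. Put $$|\zeta(\delta)\rangle=\sqrt\delta\,|u_0v_0\rangle+\sqrt{1-\delta}\,|u_1v_1\rangle,\qquad \rho(p,\delta)=p\,|u_0v_1\rangle\langle u_0v_1|+(1-p)\,|\zeta(\delta)\rangle\langle\zeta(\delta)|,\qquad |\psi(\alpha)\rangle=\sqrt\alpha\,|w_0z_0\rangle+\sqrt{1-\alpha}\,|w_1z_1\rangle ,$$ let $\eta=\rho(p,\delta)\otimes|\psi(\alpha)\rangle\langle\psi(\alpha)|$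 be the joint state of Alice, the node and Bob (the noisy segment $S_1$ joins Alice and the node and the free segment $S_2$ joins the node and Bob), and let $M(\beta)$ be the projective measurement of the node's two qubits in the orthonormal basis $$\phi_0=\sqrt\beta\,v_0w_0+\sqrt{1-\beta}\,v_1w_1,\quad \phi_1=\sqrt{1-\beta}\,v_0w_0-\sqrt\beta\,v_1w_1,\quad \phi_2=\sqrt\beta\,v_0w_1+\sqrt{1-\beta}\,v_1w_0,\quad \phi_3=\sqrt{1-\beta}\,v_0w_1-\sqrt\beta\,v_1w_0 .$$ Let $p_i$ be the probability of the outcome $\phi_i$ and $\rho_{AB,\phi_i}$ the resulting normalized state of Alice and Bob. Consider the inequalities $$\alpha\beta\,\delta(1-\delta)(1-p)^2\le(1-\alpha)(1-\beta)p^2,\qquad \alpha(1-\beta)\,\delta(1-\delta)(1-p)^2\le(1-\alpha)\beta p^2,$$ $$(1-\alpha)\beta\,\delta(1-\delta)(1-p)^2\le\alpha(1-\beta)p^2,\qquad (1-\alpha)(1-\beta)\,\delta(1-\delta)(1-p)^2\le\alpha\beta p^2. \tag{$*$}$$ Theorem 1. (a) If the four inequalities $(*)$ hold, then $$F^\star(\rho(p,\delta))=\tfrac12\Bigl(1+\frac{\delta(1-\delta)(1-p)^2}{p}\Bigr),$$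 every $p_i$ is positive, all the maxima $F^\star(\rho(p,\delta))$, $F^\star(\rho_{AB,\phi_i})$ are attained, and the end-to-end optimal fully entangled fraction $F^\star_{AB}$ equals $F^\star(\rho(p,\delta))$ in each of the following senses: (i) as the average $\sum_{i=0}^3p_iF^\star(\rho_{AB,\phi_i})$; (ii) as the maximum of $F$ of the final state of Alice and Bob over all protocols in which the node first performs $M(\beta)$ and announces the outcome, and Alice and Bob then carry out an LOCC protocol depending on it; (iii) as the maximum of $F$ of the final state of Alice and Bob over all three-party (finite-round) LOCC protocols applied to $\eta$. (b) If $p>0$, $\alpha<\dfrac{p^2}{p^2+\delta(1-\delta)(1-p)^2}$ and $\beta\le\dfrac{(1-\alpha)p^2}{(1-\alpha)p^2+\alpha\,\delta(1-\delta)(1-p)^2}$, then $(*)$ holds. (c) If $p>\frac13$, or if $p>0$ and $\delta>\frac12\Bigl(1+\sqrt{1-\frac{4p^2}{(1-p)^2}}\Bigr)$, then there are $\alpha,\beta\in(\tfrac12,1)$ for which $(*)$ holds; so non-maximally entangled resources suffice to reach the optimum. -/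

import Mathlib

open scoped Kronecker BigOperators

namespace Repeater

/-- Kets of a finite-dimensional system with computational basis `I`. -/
abbrev Ket (I : Type) := I → ℂ

/-- Operators on a finite-dimensional system with computational basis `I`. -/
abbrev Op (I : Type) := Matrix I I ℂ

/-- The rank-one operator `|v⟩⟨v|`. -/
def proj {I : Type} (v : Ket I) : Op I := Matrix.vecMulVec v (star v)

/-- A `d × d` ket is maximally entangled when its reduced state is maximally mixed: the
coefficient matrix `C i k = v (i, k)` satisfies `C * Cᴴ = (1 / d) • 1`. -/
def IsMaxEntangled {d : ℕ} (v : Ket (Fin d × Fin d)) : Prop :=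
  (Matrix.of fun i k => v (i, k)) * (Matrix.of fun i k => v (i, k)).conjTranspose
    = ((d : ℂ)⁻¹) • (1 : Op (Fin d))

/-- Fully entangled fraction `F(X) = max_φ ⟨φ|X|φ⟩` over maximally entangled `φ`. -/
noncomputable def fef {d : ℕ} (X : Op (Fin d × Fin d)) : ℝ :=
  sSup {r : ℝ | ∃ v : Ket (Fin d × Fin d), IsMaxEntangled v ∧
    r = (star v ⬝ᵥ X.mulVec v).re}

/-- Finite-round two-party LOCC protocols from local dimensions `(a, b)` to `(c, d)`.
In every step one party applies a complete set of local Kraus operators (its output dimension may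
depend on the outcome, so that local ancillas can be added or discarded) and announces the outcome;
the rest of the protocol depends on the outcome. -/
inductive Locc (c d : ℕ) : ℕ → ℕ → Type
  | done : Locc c d c d
  | alice {a b m : ℕ} (e : Fin m → ℕ) (K : (i : Fin m) → Matrix (Fin (e i)) (Fin a) ℂ)
      (hK : ∑ i, (K i).conjTranspose * K i = 1)
      (next : (i : Fin m) → Locc c d (e i) b) : Locc c d a b
  | bob {a b m : ℕ} (e : Fin m → ℕ) (K : (i : Fin m) → Matrix (Fin (e i)) (Fin b) ℂ)
      (hK : ∑ i, (K i).conjTranspose * K i = 1)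
      (next : (i : Fin m) → Locc c d a (e i)) : Locc c d a b

/-- The (trace-preserving) map on states implemented by a two-party protocol, where the outcomes
are forgotten at the end. -/
noncomputable def Locc.run {c d : ℕ} :
    {a b : ℕ} → Locc c d a b → Op (Fin a × Fin b) → Op (Fin c × Fin d)
  | _, _, .done, X => X
  | _, b, .alice _ K _ next, X =>
      ∑ i, (next i).run ((K i ⊗ₖ (1 : Op (Fin b))) * X *
        (K i ⊗ₖ (1 : Op (Fin b))).conjTranspose)
  | a, _, .bob _ K _ next, X =>
      ∑ i, (next i).run (((1 : Op (Fin a)) ⊗ₖ K i) * X *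
        ((1 : Op (Fin a)) ⊗ₖ K i).conjTranspose)

/-- The values `F(Λ(X))`, where `Λ` is an LOCC protocol with the same local dimensions. -/
def ofefValues {d : ℕ} (X : Op (Fin d × Fin d)) : Set ℝ :=
  {r : ℝ | ∃ L : Locc d d d d, r = fef (L.run X)}

/-- Optimal fully entangled fraction `F⋆(X) = max_Λ F(Λ(X))`. -/
noncomputable def ofef {d : ℕ} (X : Op (Fin d × Fin d)) : ℝ := sSup (ofefValues X)

/-- Discard the middle party (the node). -/
def traceNode {a n b : ℕ} (X : Op (Fin a × Fin n × Fin b)) : Op (Fin a × Fin b) :=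
  Matrix.of fun x y => ∑ k, X (x.1, k, x.2) (y.1, k, y.2)

/-- Finite-round three-party LOCC protocols for Alice, the node and Bob, from local dimensions
`(a, n, b)` to a state of local dimensions `(c, d)` of Alice and Bob. -/
inductive Locc3 (c d : ℕ) : ℕ → ℕ → ℕ → Type
  | done {n : ℕ} : Locc3 c d c n d
  | alice {a n b m : ℕ} (e : Fin m → ℕ) (K : (i : Fin m) → Matrix (Fin (e i)) (Fin a) ℂ)
      (hK : ∑ i, (K i).conjTranspose * K i = 1)
      (next : (i : Fin m) → Locc3 c d (e i) n b) : Locc3 c d a n b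
  | node {a n b m : ℕ} (e : Fin m → ℕ) (K : (i : Fin m) → Matrix (Fin (e i)) (Fin n) ℂ)
      (hK : ∑ i, (K i).conjTranspose * K i = 1)
      (next : (i : Fin m) → Locc3 c d a (e i) b) : Locc3 c d a n b
  | bob {a n b m : ℕ} (e : Fin m → ℕ) (K : (i : Fin m) → Matrix (Fin (e i)) (Fin b) ℂ)
      (hK : ∑ i, (K i).conjTranspose * K i = 1)
      (next : (i : Fin m) → Locc3 c d a n (e i)) : Locc3 c d a n b

/-- The map on states implemented by a three-party protocol; the node is discarded at the end. -/
noncomputable def Locc3.run {c d : ℕ} : {a n b : ℕ} → Locc3 c d a n b →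
    Op (Fin a × Fin n × Fin b) → Op (Fin c × Fin d)
  | _, _, _, .done, X => traceNode X
  | _, n, b, .alice _ K _ next, X =>
      ∑ i, (next i).run ((K i ⊗ₖ ((1 : Op (Fin n)) ⊗ₖ (1 : Op (Fin b)))) * X *
        (K i ⊗ₖ ((1 : Op (Fin n)) ⊗ₖ (1 : Op (Fin b)))).conjTranspose)
  | a, _, b, .node _ K _ next, X =>
      ∑ i, (next i).run (((1 : Op (Fin a)) ⊗ₖ (K i ⊗ₖ (1 : Op (Fin b)))) * X *
        ((1 : Op (Fin a)) ⊗ₖ (K i ⊗ₖ (1 : Op (Fin b)))).conjTranspose)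
  | a, n, _, .bob _ K _ next, X =>
      ∑ i, (next i).run (((1 : Op (Fin a)) ⊗ₖ ((1 : Op (Fin n)) ⊗ₖ K i)) * X *
        ((1 : Op (Fin a)) ⊗ₖ ((1 : Op (Fin n)) ⊗ₖ K i)).conjTranspose)

/-- The values `F(Λ(η))` at the ends, where `Λ` is any three-party LOCC protocol. -/
def endToEndValues {n : ℕ} (η : Op (Fin 2 × Fin n × Fin 2)) : Set ℝ :=
  {r : ℝ | ∃ L : Locc3 2 2 2 n 2, r = fef (L.run η)}

/-- A local orthonormal basis of a qubit: the columns of a unitary matrix. -/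
abbrev QubitBasis : Type := ↥(Matrix.unitaryGroup (Fin 2) ℂ)

/-- The product ket `|u_i⟩|v_j⟩`, where `u_i`, `v_j` are the vectors of two qubit bases. -/
def prodKet (u v : QubitBasis) (i j : Fin 2) : Ket (Fin 2 × Fin 2) :=
  fun x => u.1 x.1 i * v.1 x.2 j

/-- `√t |u_0 v_0⟩ + √(1 - t) |u_1 v_1⟩`. -/
noncomputable def schmidtKet (u v : QubitBasis) (t : ℝ) : Ket (Fin 2 × Fin 2) :=
  (√t : ℂ) • prodKet u v 0 0 + (√(1 - t) : ℂ) • prodKet u v 1 1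

/-- The noisy state `p |u_0 v_1⟩⟨u_0 v_1| + (1 - p) |ζ(δ)⟩⟨ζ(δ)|`. -/
noncomputable def noisyState (u v : QubitBasis) (p δ : ℝ) : Op (Fin 2 × Fin 2) :=
  (p : ℂ) • proj (prodKet u v 0 1) + ((1 - p : ℝ) : ℂ) • proj (schmidtKet u v δ)

/-- The four kets of the node measurement `M(β)`. -/
noncomputable def nodeKet (u v : QubitBasis) (β : ℝ) : Fin 4 → Ket (Fin 2 × Fin 2) :=
  ![(√β : ℂ) • prodKet u v 0 0 + (√(1 - β) : ℂ) • prodKet u v 1 1,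
    (√(1 - β) : ℂ) • prodKet u v 0 0 - (√β : ℂ) • prodKet u v 1 1,
    (√β : ℂ) • prodKet u v 0 1 + (√(1 - β) : ℂ) • prodKet u v 1 0,
    (√(1 - β) : ℂ) • prodKet u v 0 1 - (√β : ℂ) • prodKet u v 1 0]

/-- The joint state `ρ ⊗ σ` of Alice, the node and Bob: the node holds the second qubit of `ρ` and
the first qubit of `σ`. -/
def jointState (ρ σ : Op (Fin 2 × Fin 2)) : Op (Fin 2 × Fin (2 * 2) × Fin 2) :=
  (ρ ⊗ₖ σ).submatrix
    (fun x => ((x.1, (finProdFinEquiv.symm x.2.1).1), ((finProdFinEquiv.symm x.2.1).2, x.2.2)))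
    (fun x => ((x.1, (finProdFinEquiv.symm x.2.1).1), ((finProdFinEquiv.symm x.2.1).2, x.2.2)))

/-- The subnormalized state `Tr_N ((|φ⟩⟨φ|_N ⊗ 1_AB) η) = ⟨φ|η|φ⟩` of Alice and Bob after the node
has obtained the outcome `φ`. -/
noncomputable def collapse (φ : Ket (Fin 2 × Fin 2)) (η : Op (Fin 2 × Fin (2 * 2) × Fin 2)) :
    Op (Fin 2 × Fin 2) :=
  Matrix.of fun x y => ∑ k, ∑ l, star (φ (finProdFinEquiv.symm k)) *
    η (x.1, k, x.2) (y.1, l, y.2) * φ (finProdFinEquiv.symm l)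

/-- Probability of the outcome `φ`. -/
noncomputable def outcomeProb (φ : Ket (Fin 2 × Fin 2))
    (η : Op (Fin 2 × Fin (2 * 2) × Fin 2)) : ℝ := (collapse φ η).trace.re

/-- Normalized state of Alice and Bob after the outcome `φ`. -/
noncomputable def postState (φ : Ket (Fin 2 × Fin 2))
    (η : Op (Fin 2 × Fin (2 * 2) × Fin 2)) : Op (Fin 2 × Fin 2) :=
  ((outcomeProb φ η)⁻¹ : ℂ) • collapse φ η

/-- The values `F(Λ(η))` at the ends, where `Λ` ranges over the protocols in which the node first
measures in the basis `φ` and announces the outcome `i`, whereupon Alice and Bob carry out an LOCC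
protocol `L i` of their choice. -/
def measuredValues (φ : Fin 4 → Ket (Fin 2 × Fin 2))
    (η : Op (Fin 2 × Fin (2 * 2) × Fin 2)) : Set ℝ :=
  {r : ℝ | ∃ L : Fin 4 → Locc 2 2 2 2, r = fef (∑ i, (L i).run (collapse (φ i) η))}

/-- The four inequalities on the parameters. -/
def Admissible (p δ α β : ℝ) : Prop :=
  α * β * δ * (1 - δ) * (1 - p) ^ 2 ≤ (1 - α) * (1 - β) * p ^ 2 ∧
  α * (1 - β) * δ * (1 - δ) * (1 - p) ^ 2 ≤ (1 - α) * β * p ^ 2 ∧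
  (1 - α) * β * δ * (1 - δ) * (1 - p) ^ 2 ≤ α * (1 - β) * p ^ 2 ∧
  (1 - α) * (1 - β) * δ * (1 - δ) * (1 - p) ^ 2 ≤ α * β * p ^ 2

end Repeater

open Repeater

namespace Repeater

/-! Write D = δ(1-δ)(1-p)². The proof sandwiches all end-to-end values between an upper bound from
the noisy segment alone and a lower bound from explicit filters.

Upper bound: adding a suitable positive multiple of |u_1 v_0⟩⟨u_1 v_0| to P|u_0 v_1⟩⟨u_0 v_1| +
q|ξ⟩⟨ξ| makes it a mixture of four product kets, all of the same norm (`exists_separable`). An LOCC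
protocol keeps product kets product and preserves their total weight, and a product ket overlaps a
maximally entangled one by at most 1/2 of its weight; so every protocol is bounded by `mixValue`
(`quad_map_mixState_le`). Attaching the free segment to the node keeps the kets product across the
cut between Alice and the rest, so three-party protocols obey the same bound
(`Locc3.quad_run_jointState_le`).

Lower bound: Alice damps u_0 by a = qgh/P; if this fails, Bob resets his qubit to obtain a product
state of overlap 1/2. This reaches `mixValue` as soon as |a| ≤ 1 (`exists_quad_run_eq_mixValue`).

Each outcome of the node again yields a state of this family (`collapse_schmidt`), and the four
inequalities say exactly that |a| ≤ 1 for each of them. All four filters aim at one and the same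
Bell ket, so their overlaps add up, and the sum is the upper bound (`sum_outcomeValue`). -/

/-! ### Kets, norms and expectation values. -/

/-- The product ket `x ⊗ y`. -/
def tens {I J : Type} (x : Ket I) (y : Ket J) : Ket (I × J) := fun q => x q.1 * y q.2

/-- The squared norm of a ket. -/
noncomputable def nsq {I : Type} [Fintype I] (x : Ket I) : ℝ := ∑ i, Complex.normSq (x i)

/-- The real part of the expectation value `⟨v|X|v⟩`. -/
noncomputable def quad {I : Type} [Fintype I] (v : Ket I) (X : Op I) : ℝ :=
  (star v ⬝ᵥ X.mulVec v).re

lemma proj_smul {I : Type} (c : ℂ) (ξ : Ket I) : proj (c • ξ) = ((Complex.normSq c : ℝ) : ℂ) • proj ξ := by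
  ext i j
  rw [Complex.normSq_eq_conj_mul_self]
  simp [proj, Matrix.vecMulVec_apply]
  ring

section Kets

variable {I J : Type} [Fintype I] [Fintype J]

lemma nsq_eq_dotProduct (x : Ket I) : ((nsq x : ℝ) : ℂ) = star x ⬝ᵥ x := by
  simp [nsq, dotProduct, Complex.normSq_eq_conj_mul_self]

lemma dotProduct_tens (x x' : Ket I) (y y' : Ket J) :
    star (tens x y) ⬝ᵥ tens x' y' = (star x ⬝ᵥ x') * (star y ⬝ᵥ y') := by
  simp only [dotProduct, tens, Fintype.sum_prod_type, Finset.sum_mul_sum, Pi.star_apply, star_mul']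
  exact Finset.sum_congr rfl fun _ _ => Finset.sum_congr rfl fun _ _ => by ring

lemma kronecker_mulVec_tens {I' J' : Type} (A : Matrix I' I ℂ) (B : Matrix J' J ℂ)
    (x : Ket I) (y : Ket J) : (A ⊗ₖ B).mulVec (tens x y) = tens (A.mulVec x) (B.mulVec y) := by
  ext q
  simp only [Matrix.mulVec, dotProduct, tens, Fintype.sum_prod_type, Finset.sum_mul_sum,
    Matrix.kroneckerMap_apply]
  exact Finset.sum_congr rfl fun _ _ => Finset.sum_congr rfl fun _ _ => by ring

lemma mul_proj_mul {I' : Type} (M : Matrix I' I ℂ) (ξ : Ket I) :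
    M * proj ξ * M.conjTranspose = proj (M.mulVec ξ) := by
  rw [proj, proj, Matrix.mul_vecMulVec, Matrix.vecMulVec_mul, Matrix.star_mulVec]

lemma quad_smul (v : Ket I) (c : ℝ) (X : Op I) : quad v ((c : ℂ) • X) = c * quad v X := by
  simp [quad, Matrix.smul_mulVec]

/-- `quad v` as a real linear functional. -/
noncomputable def quadLin (v : Ket I) : Op I →ₗ[ℝ] ℝ where
  toFun := quad v
  map_add' X Y := by simp [quad, Matrix.add_mulVec]
  map_smul' c X := by
    have h : c • X = (c : ℂ) • X := by ext; simp
    rw [h, quad_smul, RingHom.id_apply, smul_eq_mul]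

lemma quad_add (v : Ket I) (X Y : Op I) : quad v (X + Y) = quad v X + quad v Y :=
  (quadLin v).map_add X Y

lemma quad_sum {ι : Type} (s : Finset ι) (v : Ket I) (X : ι → Op I) :
    quad v (∑ i ∈ s, X i) = ∑ i ∈ s, quad v (X i) := map_sum (quadLin v) X s

lemma quad_proj (v ξ : Ket I) : quad v (proj ξ) = Complex.normSq (star v ⬝ᵥ ξ) := by
  have h : star ξ ⬝ᵥ v = star (star v ⬝ᵥ ξ) := by
    rw [Matrix.star_dotProduct]
  rw [quad, proj, Matrix.vecMulVec_mulVec, h]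
  simp [Complex.normSq_apply]

lemma sum_nsq_mulVec [DecidableEq I] {m : ℕ} {e : Fin m → Type} [∀ i, Fintype (e i)]
    (K : (i : Fin m) → Matrix (e i) I ℂ) (hK : ∑ i, (K i).conjTranspose * K i = 1) (x : Ket I) :
    ∑ i, nsq ((K i).mulVec x) = nsq x := by
  apply Complex.ofReal_injective
  push_cast
  simp only [nsq_eq_dotProduct, Matrix.star_mulVec, ← Matrix.dotProduct_mulVec,
    Matrix.mulVec_mulVec]
  rw [← dotProduct_sum, ← Matrix.sum_mulVec, hK, Matrix.one_mulVec]

lemma normSq_dotProduct_le (x y : Ket I) : Complex.normSq (x ⬝ᵥ y) ≤ nsq x * nsq y := by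
  have h1 : ‖x ⬝ᵥ y‖ ≤ ∑ i, ‖x i‖ * ‖y i‖ := by
    refine (norm_sum_le _ _).trans (le_of_eq ?_)
    simp
  have h2 := Finset.sum_mul_sq_le_sq_mul_sq Finset.univ (fun i => ‖x i‖) (fun i => ‖y i‖)
  simp only [nsq, Complex.normSq_eq_norm_sq]
  exact (pow_le_pow_left₀ (norm_nonneg _) h1 2).trans h2

end Kets

/-! ### LOCC protocols acting on product kets. -/

/-- The overlap of a product ket with a maximally entangled ket is at most `1 / d`. -/
lemma IsMaxEntangled.normSq_dotProduct_tens_le {d : ℕ} {v : Ket (Fin d × Fin d)}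
    (hv : IsMaxEntangled v) (x y : Ket (Fin d)) :
    Complex.normSq (star v ⬝ᵥ tens x y) ≤ (d : ℝ)⁻¹ * (nsq x * nsq y) := by
  set C : Op (Fin d) := Matrix.of fun i k => v (i, k) with hC
  have h1 : star v ⬝ᵥ tens x y = C.conjTranspose.mulVec x ⬝ᵥ y := by
    simp only [dotProduct, tens, Fintype.sum_prod_type_right, Matrix.mulVec, Finset.sum_mul,
      Matrix.conjTranspose_apply, hC, Matrix.of_apply, Pi.star_apply]
    exact Finset.sum_congr rfl fun _ _ => Finset.sum_congr rfl fun _ _ => by ring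
  -- Maximal entanglement makes Cᴴ a multiple of an isometry; Cauchy–Schwarz then finishes.
  have h2 : nsq (C.conjTranspose.mulVec x) = (d : ℝ)⁻¹ * nsq x := by
    apply Complex.ofReal_injective
    have hCC : C * C.conjTranspose = ((d : ℂ)⁻¹) • (1 : Op (Fin d)) := hv
    push_cast
    rw [nsq_eq_dotProduct, nsq_eq_dotProduct, Matrix.star_mulVec, ← Matrix.dotProduct_mulVec,
      Matrix.mulVec_mulVec, Matrix.conjTranspose_conjTranspose, hCC, Matrix.smul_mulVec,
      Matrix.one_mulVec, dotProduct_smul, smul_eq_mul]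
  rw [h1, ← mul_assoc, ← h2]
  exact normSq_dotProduct_le _ _

/-- `Locc.run` as a linear map. -/
noncomputable def Locc.runLin {c d : ℕ} {a b : ℕ} (L : Locc c d a b) :
    Op (Fin a × Fin b) →ₗ[ℂ] Op (Fin c × Fin d) where
  toFun := L.run
  map_add' X Y := by
    induction L with
    | done => rfl
    | alice e K hK next ih => simp only [Locc.run, Matrix.mul_add, Matrix.add_mul, ih, Finset.sum_add_distrib]
    | bob e K hK next ih => simp only [Locc.run, Matrix.mul_add, Matrix.add_mul, ih, Finset.sum_add_distrib]
  map_smul' r X := by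
    induction L with
    | done => rfl
    | alice e K hK next ih =>
      simp only [RingHom.id_apply] at ih
      simp only [Locc.run, Matrix.mul_smul, Matrix.smul_mul, ih, RingHom.id_apply, Finset.smul_sum]
    | bob e K hK next ih =>
      simp only [RingHom.id_apply] at ih
      simp only [Locc.run, Matrix.mul_smul, Matrix.smul_mul, ih, RingHom.id_apply, Finset.smul_sum]

lemma traceNode_add {a n b : ℕ} (X Y : Op (Fin a × Fin n × Fin b)) :
    traceNode (X + Y) = traceNode X + traceNode Y := by
  ext; simp [traceNode, Finset.sum_add_distrib]

lemma traceNode_smul {a n b : ℕ} (r : ℂ) (X : Op (Fin a × Fin n × Fin b)) :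
    traceNode (r • X) = r • traceNode X := by
  ext; simp [traceNode, Finset.mul_sum]

/-- `Locc3.run` as a linear map. -/
noncomputable def Locc3.runLin {c d : ℕ} {a n b : ℕ} (L : Locc3 c d a n b) :
    Op (Fin a × Fin n × Fin b) →ₗ[ℂ] Op (Fin c × Fin d) where
  toFun := L.run
  map_add' X Y := by
    induction L with
    | done => exact traceNode_add X Y
    | alice e K hK next ih => simp only [Locc3.run, Matrix.mul_add, Matrix.add_mul, ih, Finset.sum_add_distrib]
    | node e K hK next ih => simp only [Locc3.run, Matrix.mul_add, Matrix.add_mul, ih, Finset.sum_add_distrib]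
    | bob e K hK next ih => simp only [Locc3.run, Matrix.mul_add, Matrix.add_mul, ih, Finset.sum_add_distrib]
  map_smul' r X := by
    induction L with
    | done => exact traceNode_smul r X
    | alice e K hK next ih | node e K hK next ih | bob e K hK next ih =>
      simp only [RingHom.id_apply] at ih
      simp only [Locc3.run, Matrix.mul_smul, Matrix.smul_mul, ih, RingHom.id_apply, Finset.smul_sum]

/-- A two-party protocol does not raise the overlap of a product state with a maximally entangled
state above `1 / d`. -/
lemma Locc.quad_run_tens {d a b : ℕ} (L : Locc d d a b) {v : Ket (Fin d × Fin d)}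
    (hv : IsMaxEntangled v) (x : Ket (Fin a)) (y : Ket (Fin b)) :
    0 ≤ quad v (L.run (proj (tens x y))) ∧
      quad v (L.run (proj (tens x y))) ≤ (d : ℝ)⁻¹ * (nsq x * nsq y) := by
  induction L with
  | done =>
    rw [Locc.run, quad_proj]
    exact ⟨Complex.normSq_nonneg _, hv.normSq_dotProduct_tens_le x y⟩
  | alice e K hK next ih =>
    -- Each branch is again an unnormalized product ket, and completeness of the Kraus family
    -- preserves the sum of the squared norms.
    simp only [Locc.run, mul_proj_mul, kronecker_mulVec_tens, Matrix.one_mulVec, quad_sum]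
    refine ⟨Finset.sum_nonneg fun i _ => (ih i _ _).1,
      (Finset.sum_le_sum fun i _ => (ih i _ _).2).trans_eq ?_⟩
    rw [← Finset.mul_sum, ← Finset.sum_mul, sum_nsq_mulVec K hK]
  | bob e K hK next ih =>
    simp only [Locc.run, mul_proj_mul, kronecker_mulVec_tens, Matrix.one_mulVec, quad_sum]
    refine ⟨Finset.sum_nonneg fun i _ => (ih i _ _).1,
      (Finset.sum_le_sum fun i _ => (ih i _ _).2).trans_eq ?_⟩
    rw [← Finset.mul_sum, ← Finset.mul_sum, sum_nsq_mulVec K hK]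

lemma traceNode_proj_tens {a n b : ℕ} (x : Ket (Fin a)) (χ : Ket (Fin n × Fin b)) :
    traceNode (proj (tens x χ)) = ∑ k, proj (tens x fun l => χ (k, l)) := by
  ext q r
  simp [traceNode, proj, tens, Matrix.vecMulVec_apply, Matrix.sum_apply]

/-- A three-party protocol does not raise the overlap of a state that is a product between Alice
and the others with a maximally entangled state above `1 / d`. -/
lemma Locc3.quad_run_tens {d a n b : ℕ} (L : Locc3 d d a n b) {v : Ket (Fin d × Fin d)}
    (hv : IsMaxEntangled v) (x : Ket (Fin a)) (χ : Ket (Fin n × Fin b)) :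
    0 ≤ quad v (L.run (proj (tens x χ))) ∧
      quad v (L.run (proj (tens x χ))) ≤ (d : ℝ)⁻¹ * (nsq x * nsq χ) := by
  induction L with
  | done =>
    -- Discarding the node splits `χ` into slices whose squared norms add up to that of `χ`.
    simp only [Locc3.run, traceNode_proj_tens, quad_sum, quad_proj]
    refine ⟨Finset.sum_nonneg fun _ _ => Complex.normSq_nonneg _,
      (Finset.sum_le_sum fun k _ => hv.normSq_dotProduct_tens_le _ _).trans_eq ?_⟩
    rw [← Finset.mul_sum, ← Finset.mul_sum]
    simp [nsq, Fintype.sum_prod_type]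
  | alice e K hK next ih =>
    simp only [Locc3.run, mul_proj_mul, kronecker_mulVec_tens, Matrix.one_mulVec, quad_sum,
      Matrix.one_kronecker_one]
    refine ⟨Finset.sum_nonneg fun i _ => (ih i _ _).1,
      (Finset.sum_le_sum fun i _ => (ih i _ _).2).trans_eq ?_⟩
    rw [← Finset.mul_sum, ← Finset.sum_mul, sum_nsq_mulVec K hK]
  | node e K hK next ih =>
    simp only [Locc3.run, mul_proj_mul, kronecker_mulVec_tens, Matrix.one_mulVec, quad_sum]
    refine ⟨Finset.sum_nonneg fun i _ => (ih i _ _).1,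
      (Finset.sum_le_sum fun i _ => (ih i _ _).2).trans_eq ?_⟩
    -- The node and Bob count as one party, on which K ⊗ 1 is a complete Kraus family.
    rw [← Finset.mul_sum, ← Finset.mul_sum, sum_nsq_mulVec (fun i => K i ⊗ₖ (1 : Op (Fin _)))]
    simp_rw [Matrix.conjTranspose_kronecker, ← Matrix.mul_kronecker_mul, Matrix.conjTranspose_one,
      mul_one]
    rw [← Matrix.one_kronecker_one, ← hK]
    ext; simp [Matrix.sum_apply, Finset.sum_mul]
  | bob e K hK next ih =>
    simp only [Locc3.run, mul_proj_mul, kronecker_mulVec_tens, Matrix.one_mulVec, quad_sum]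
    refine ⟨Finset.sum_nonneg fun i _ => (ih i _ _).1,
      (Finset.sum_le_sum fun i _ => (ih i _ _).2).trans_eq ?_⟩
    rw [← Finset.mul_sum, ← Finset.mul_sum, sum_nsq_mulVec (fun i => (1 : Op (Fin _)) ⊗ₖ K i)]
    simp_rw [Matrix.conjTranspose_kronecker, ← Matrix.mul_kronecker_mul, Matrix.conjTranspose_one,
      mul_one]
    rw [← Matrix.one_kronecker_one, ← hK]
    ext; simp [Matrix.sum_apply, Finset.mul_sum]

/-! ### Protocols with an idle node. -/

/-- A two-party protocol as a three-party protocol in which the node is idle. -/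
def Locc.toLocc3 {c d : ℕ} (n : ℕ) : {a b : ℕ} → Locc c d a b → Locc3 c d a n b
  | _, _, .done => .done
  | _, _, .alice e K hK next => .alice e K hK fun i => (next i).toLocc3 n
  | _, _, .bob e K hK next => .bob e K hK fun i => (next i).toLocc3 n

lemma traceNode_alice {a a' n b : ℕ} (K : Matrix (Fin a') (Fin a) ℂ)
    (X : Op (Fin a × Fin n × Fin b)) :
    traceNode ((K ⊗ₖ ((1 : Op (Fin n)) ⊗ₖ (1 : Op (Fin b)))) * X *
        (K ⊗ₖ ((1 : Op (Fin n)) ⊗ₖ (1 : Op (Fin b)))).conjTranspose) =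
      (K ⊗ₖ (1 : Op (Fin b))) * traceNode X * (K ⊗ₖ (1 : Op (Fin b))).conjTranspose := by
  ext q r
  simp only [traceNode, Matrix.of_apply, Matrix.mul_apply, Matrix.kroneckerMap_apply,
    Fintype.sum_prod_type, Matrix.one_apply, Matrix.conjTranspose_apply, mul_ite, ite_mul, mul_one,
    mul_zero, zero_mul, Finset.sum_ite_eq, Finset.mem_univ, if_true, apply_ite star, star_zero,
    Finset.mul_sum, Finset.sum_mul, Finset.sum_ite_irrel, Finset.sum_const_zero]
  rw [Finset.sum_comm]
  exact Finset.sum_congr rfl fun _ _ => Finset.sum_comm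

lemma traceNode_bob {a n b b' : ℕ} (K : Matrix (Fin b') (Fin b) ℂ)
    (X : Op (Fin a × Fin n × Fin b)) :
    traceNode (((1 : Op (Fin a)) ⊗ₖ ((1 : Op (Fin n)) ⊗ₖ K)) * X *
        ((1 : Op (Fin a)) ⊗ₖ ((1 : Op (Fin n)) ⊗ₖ K)).conjTranspose) =
      ((1 : Op (Fin a)) ⊗ₖ K) * traceNode X * ((1 : Op (Fin a)) ⊗ₖ K).conjTranspose := by
  ext q r
  simp only [traceNode, Matrix.of_apply, Matrix.mul_apply, Matrix.kroneckerMap_apply,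
    Fintype.sum_prod_type, Matrix.one_apply, Matrix.conjTranspose_apply, mul_ite, ite_mul, one_mul,
    mul_zero, zero_mul, Finset.sum_ite_eq, Finset.mem_univ, if_true, apply_ite star, star_zero,
    Finset.mul_sum, Finset.sum_mul, Finset.sum_ite_irrel, Finset.sum_const_zero]
  rw [Finset.sum_comm]
  exact Finset.sum_congr rfl fun _ _ => Finset.sum_comm

/-- The partial trace over an idle node commutes with every step of Alice and Bob, so it can be
moved from the end of the protocol to its beginning. -/
lemma Locc.run_toLocc3 {c d : ℕ} (n : ℕ) {a b : ℕ} (L : Locc c d a b)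
    (X : Op (Fin a × Fin n × Fin b)) : (L.toLocc3 n).run X = L.run (traceNode X) := by
  induction L with
  | done => rfl
  | alice e K hK next ih => simp only [Locc.toLocc3, Locc3.run, Locc.run, ih, traceNode_alice]
  | bob e K hK next ih => simp only [Locc.toLocc3, Locc3.run, Locc.run, ih, traceNode_bob]

/-! ### The fully entangled fraction as a supremum. -/

/-- A real `sSup` is meaningful only for nonempty bounded sets. Here and in the next two lemmas `hB`
supplies the bound and `v₀` the element. -/
lemma IsMaxEntangled.quad_le_fef {d : ℕ} {v₀ : Ket (Fin d × Fin d)} {X : Op (Fin d × Fin d)}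
    {B : ℝ} (hB : ∀ v, IsMaxEntangled v → quad v X ≤ B) (hv₀ : IsMaxEntangled v₀) :
    quad v₀ X ≤ fef X :=
  le_csSup ⟨B, by rintro r ⟨v, hv, rfl⟩; exact hB v hv⟩ ⟨v₀, hv₀, rfl⟩

lemma IsMaxEntangled.fef_le {d : ℕ} {v₀ : Ket (Fin d × Fin d)} {X : Op (Fin d × Fin d)}
    {B : ℝ} (hB : ∀ v, IsMaxEntangled v → quad v X ≤ B) (hv₀ : IsMaxEntangled v₀) :
    fef X ≤ B :=
  csSup_le ⟨_, v₀, hv₀, rfl⟩ (by rintro r ⟨v, hv, rfl⟩; exact hB v hv)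

lemma IsMaxEntangled.fef_eq {d : ℕ} {v₀ : Ket (Fin d × Fin d)} {X : Op (Fin d × Fin d)}
    {B : ℝ} (hB : ∀ v, IsMaxEntangled v → quad v X ≤ B) (hv₀ : IsMaxEntangled v₀)
    (h : quad v₀ X = B) : fef X = B :=
  le_antisymm (hv₀.fef_le hB) (h ▸ hv₀.quad_le_fef hB)

/-! ### Qubit bases and Bell kets. -/

/-- The `i`-th vector of a qubit basis. -/
def basisKet (u : QubitBasis) (i : Fin 2) : Ket (Fin 2) := fun a => u.1 a i

lemma prodKet_eq_tens (u v : QubitBasis) (i j : Fin 2) :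
    prodKet u v i j = tens (basisKet u i) (basisKet v j) := rfl

lemma basisKet_eq_mulVec (u : QubitBasis) (i : Fin 2) :
    basisKet u i = u.1.mulVec (Pi.single i 1) := by
  ext a; simp [basisKet]

lemma conjTranspose_mul_self_unitary (u : QubitBasis) : u.1.conjTranspose * u.1 = 1 :=
  Matrix.mem_unitaryGroup_iff'.1 u.2

lemma mul_conjTranspose_self_unitary (u : QubitBasis) : u.1 * u.1.conjTranspose = 1 :=
  Matrix.mem_unitaryGroup_iff.1 u.2

lemma basisKet_dotProduct (u : QubitBasis) (i j : Fin 2) :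
    star (basisKet u i) ⬝ᵥ basisKet u j = if i = j then 1 else 0 := by
  rw [← Matrix.one_apply, ← conjTranspose_mul_self_unitary u, Matrix.mul_apply]
  rfl

lemma prodKet_dotProduct (u v : QubitBasis) (i j k l : Fin 2) :
    star (prodKet u v i j) ⬝ᵥ prodKet u v k l =
      (if i = k then 1 else 0) * (if j = l then 1 else 0) := by
  rw [prodKet_eq_tens, prodKet_eq_tens, dotProduct_tens, basisKet_dotProduct, basisKet_dotProduct]

/-- The operator that has the matrix `M` with respect to the bases `u` and `u'`. -/
def changeBasis (u' u : QubitBasis) (M : Op (Fin 2)) : Op (Fin 2) :=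
  u'.1 * M * u.1.conjTranspose

lemma changeBasis_mulVec (u' u : QubitBasis) (M : Op (Fin 2)) (i : Fin 2) :
    (changeBasis u' u M).mulVec (basisKet u i) = ∑ k, M k i • basisKet u' k := by
  rw [basisKet_eq_mulVec, Matrix.mulVec_mulVec, changeBasis, Matrix.mul_assoc,
    conjTranspose_mul_self_unitary, Matrix.mul_one]
  ext a
  simp [basisKet, Matrix.mul_apply, mul_comm]

lemma changeBasis_conjTranspose_mul (u' u : QubitBasis) (M : Op (Fin 2)) :
    (changeBasis u' u M).conjTranspose * changeBasis u' u M =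
      u.1 * (M.conjTranspose * M) * u.1.conjTranspose := by
  have h := conjTranspose_mul_self_unitary u'
  calc _ = u.1 * M.conjTranspose * (u'.1.conjTranspose * u'.1) * (M * u.1.conjTranspose) := by
        simp only [changeBasis, Matrix.conjTranspose_mul, Matrix.conjTranspose_conjTranspose,
          Matrix.mul_assoc]
    _ = _ := by rw [h]; simp only [Matrix.mul_one, Matrix.mul_assoc]

/-- The ket `(|u_0 v_0⟩ + |u_1 v_1⟩) / √2`. -/
noncomputable def bellKet (u v : QubitBasis) : Ket (Fin 2 × Fin 2) :=
  ((√2)⁻¹ : ℂ) • (prodKet u v 0 0 + prodKet u v 1 1)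

lemma inv_sqrt_two_sq : ((√2 : ℝ) : ℂ)⁻¹ * ((√2 : ℝ) : ℂ)⁻¹ = 2⁻¹ := by
  rw [← mul_inv, ← Complex.ofReal_mul, Real.mul_self_sqrt zero_le_two]
  norm_num

lemma isMaxEntangled_bellKet (u v : QubitBasis) : IsMaxEntangled (bellKet u v) := by
  have h : (Matrix.of fun i k => bellKet u v (i, k)) = ((√2)⁻¹ : ℂ) • (u.1 * v.1.transpose) := by
    ext i k
    simp [bellKet, prodKet, Matrix.mul_apply]
  have hv : v.1.transpose * v.1.transpose.conjTranspose = 1 := by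
    have h := congrArg Matrix.transpose (conjTranspose_mul_self_unitary v)
    rwa [Matrix.transpose_mul, Matrix.transpose_one] at h
  rw [IsMaxEntangled, h, Matrix.conjTranspose_smul, Matrix.smul_mul, Matrix.mul_smul, smul_smul,
    Matrix.conjTranspose_mul, Matrix.mul_assoc, ← Matrix.mul_assoc v.1.transpose, hv,
    Matrix.one_mul, mul_conjTranspose_self_unitary]
  congr 1
  simpa using inv_sqrt_two_sq

lemma normSq_bellKet_dotProduct (u v : QubitBasis) (a b c : ℂ) :
    Complex.normSq (star (bellKet u v) ⬝ᵥ
      (a • prodKet u v 0 0 + b • prodKet u v 1 1 + c • prodKet u v 0 1)) =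
      Complex.normSq (a + b) / 2 := by
  have h : star (bellKet u v) ⬝ᵥ
      (a • prodKet u v 0 0 + b • prodKet u v 1 1 + c • prodKet u v 0 1) =
      ((√2 : ℝ) : ℂ)⁻¹ * (a + b) := by
    simp [bellKet, prodKet_dotProduct, dotProduct_add, add_dotProduct]
    ring
  rw [h, map_mul, map_inv₀, Complex.normSq_ofReal, Real.mul_self_sqrt zero_le_two]
  ring

/-! ### The family `mixState` and its separable majorant. -/

/-- The operator `P |u_0 v_1⟩⟨u_0 v_1| + q |ξ⟩⟨ξ|` with `ξ = g |u_0 v_0⟩ + h |u_1 v_1⟩`. -/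
noncomputable def mixState (u v : QubitBasis) (P q g h : ℝ) : Op (Fin 2 × Fin 2) :=
  (P : ℂ) • proj (prodKet u v 0 1) +
    (q : ℂ) • proj ((g : ℂ) • prodKet u v 0 0 + (h : ℂ) • prodKet u v 1 1)

/-- The optimal fully entangled fraction of `mixState u v P q g h`. -/
noncomputable def mixValue (P q g h : ℝ) : ℝ :=
  1 / 2 * (P + q * (g ^ 2 + h ^ 2) + (q * g * h) ^ 2 / P)

lemma smul_mixState (u v : QubitBasis) (c P q g h : ℝ) :
    (c : ℂ) • mixState u v P q g h = mixState u v (c * P) (c * q) g h := by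
  simp only [mixState, smul_add, smul_smul, Complex.ofReal_mul]

lemma mixValue_mul {c : ℝ} (hc : c ≠ 0) (P q g h : ℝ) :
    mixValue (c * P) (c * q) g h = c * mixValue P q g h := by
  have : (c * q * g * h) ^ 2 / (c * P) = c * ((q * g * h) ^ 2 / P) := by
    rw [show (c * q * g * h) ^ 2 = c * (c * (q * g * h) ^ 2) by ring, mul_div_mul_left _ _ hc,
      mul_div_assoc]
  rw [mixValue, mixValue, this]
  ring

lemma trace_proj {I : Type} [Fintype I] (x : Ket I) : (proj x).trace = nsq x := by
  rw [nsq_eq_dotProduct, proj, Matrix.trace_vecMulVec, dotProduct_comm]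

lemma nsq_prodKet (u v : QubitBasis) (i j : Fin 2) : nsq (prodKet u v i j) = 1 := by
  apply Complex.ofReal_injective
  rw [nsq_eq_dotProduct, prodKet_dotProduct]
  simp

lemma nsq_schmidt (u v : QubitBasis) (g h : ℂ) :
    nsq (g • prodKet u v 0 0 + h • prodKet u v 1 1) = Complex.normSq g + Complex.normSq h := by
  apply Complex.ofReal_injective
  rw [nsq_eq_dotProduct]
  simp [prodKet_dotProduct, dotProduct_add, add_dotProduct, Complex.normSq_eq_conj_mul_self]
  ring

lemma nsq_basis (u : QubitBasis) (g h : ℂ) :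
    nsq (g • basisKet u 0 + h • basisKet u 1) = Complex.normSq g + Complex.normSq h := by
  apply Complex.ofReal_injective
  rw [nsq_eq_dotProduct]
  simp only [star_add, star_smul, add_dotProduct, dotProduct_add, smul_dotProduct, dotProduct_smul,
    basisKet_dotProduct, Complex.ofReal_add, Complex.normSq_eq_conj_mul_self, smul_eq_mul]
  simp
  ring

lemma trace_mixState (u v : QubitBasis) (P q g h : ℝ) :
    (mixState u v P q g h).trace.re = P + q * (g ^ 2 + h ^ 2) := by
  rw [mixState, Matrix.trace_add, Matrix.trace_smul, Matrix.trace_smul, trace_proj, trace_proj,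
    nsq_prodKet, nsq_schmidt]
  simp [sq]

/-- Averaging over the relative phases removes the interference terms. -/
lemma sum_proj_phases {I : Type} (A B C : Ket I) :
    ∑ k : Fin 4, proj (A + (-Complex.I) ^ (k : ℕ) • B + Complex.I ^ (k : ℕ) • C) =
      (4 : ℂ) • (proj A + proj B + proj C) := by
  ext i j
  have h3 : Complex.I ^ 3 = -Complex.I := Complex.I_pow_three
  have h3' : (-Complex.I) ^ 3 = Complex.I := by rw [Odd.neg_pow (by decide), h3, neg_neg]
  -- The cross terms of A with B and with C carry the phases (±i)^k, those of B with C carry (-1)^k;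
  -- each sums to zero over four consecutive k.
  simp only [Fin.sum_univ_four, proj, Matrix.add_apply, Matrix.vecMulVec_apply, Matrix.smul_apply,
    Pi.add_apply, Pi.smul_apply, Pi.star_apply, smul_eq_mul, star_add, star_mul', Fin.val_zero,
    Fin.val_one, Fin.val_two, pow_zero, pow_one, one_mul, neg_sq, Complex.I_sq,
    show ((3 : Fin 4) : ℕ) = 3 from rfl, h3, h3', Complex.star_def, map_neg, map_one, Complex.conj_I]
  ring_nf
  simp only [Complex.I_sq]
  ring

/-- `mixState` is dominated by a separable operator, an average of four product states. -/
lemma exists_separable (u v : QubitBasis) {P q : ℝ} (hP : 0 < P) (hq : 0 ≤ q) (g h : ℝ) :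
    ∃ x y : Fin 4 → Ket (Fin 2),
      mixState u v P q g h + (((q * g * h) ^ 2 / P : ℝ) : ℂ) • proj (prodKet u v 1 0) =
        ((4⁻¹ : ℝ) : ℂ) • ∑ k, proj (tens (x k) (y k)) ∧
      ∀ k, (2 : ℝ)⁻¹ * (nsq (x k) * nsq (y k)) = mixValue P q g h := by
  have hsP : √P ≠ 0 := (Real.sqrt_pos.2 hP).ne'
  have hPP : √P * √P = P := Real.mul_self_sqrt hP.le
  have hqq : √q * √q = q := Real.mul_self_sqrt hq
  have hsP' : ((√P : ℝ) : ℂ) ≠ 0 := by exact_mod_cast hsP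
  have hqq' : ((√q : ℝ) : ℂ) * ((√q : ℝ) : ℂ) = q := by exact_mod_cast hqq
  -- The opposite phases cancel on u_1 v_1, so the u_0 v_0 and u_1 v_1 parts always form √q ξ, while
  -- u_0 v_1 and u_1 v_0 get phases that average out. The product of squared norms is (1 +
  -- qh²/P)(qg² + P), twice `mixValue`.
  refine ⟨fun k => (1 : ℂ) • basisKet u 0 +
      (Complex.I ^ (k : ℕ) * ((√q * h / √P : ℝ) : ℂ)) • basisKet u 1,
    fun k => ((√q * g : ℝ) : ℂ) • basisKet v 0 +
      ((-Complex.I) ^ (k : ℕ) * ((√P : ℝ) : ℂ)) • basisKet v 1, ?_, fun k => ?_⟩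
  · have hk : ∀ k : Fin 4, tens ((1 : ℂ) • basisKet u 0 +
        (Complex.I ^ (k : ℕ) * ((√q * h / √P : ℝ) : ℂ)) • basisKet u 1)
        (((√q * g : ℝ) : ℂ) • basisKet v 0 +
          ((-Complex.I) ^ (k : ℕ) * ((√P : ℝ) : ℂ)) • basisKet v 1) =
        ((√q : ℝ) : ℂ) • ((g : ℂ) • prodKet u v 0 0 + (h : ℂ) • prodKet u v 1 1) +
          (-Complex.I) ^ (k : ℕ) • (((√P : ℝ) : ℂ) • prodKet u v 0 1) +
          Complex.I ^ (k : ℕ) • (((q * g * h / √P : ℝ) : ℂ) • prodKet u v 1 0) := by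
      intro k
      have hI : Complex.I ^ (k : ℕ) * (-Complex.I) ^ (k : ℕ) = 1 := by
        rw [← mul_pow]; simp
      ext r
      simp only [tens, prodKet, basisKet, Pi.add_apply, Pi.smul_apply, smul_eq_mul]
      push_cast
      rw [← hqq']
      field_simp
      linear_combination ((√q : ℝ) : ℂ) * h * ((√P : ℝ) : ℂ) * u.1 r.1 1 * v.1 r.2 1 * hI
    simp only [hk]
    rw [sum_proj_phases, proj_smul, proj_smul, proj_smul, smul_smul, Complex.normSq_ofReal,
      Complex.normSq_ofReal, Complex.normSq_ofReal, hqq, hPP, mixState,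
      show q * g * h / √P * (q * g * h / √P) = (q * g * h) ^ 2 / P by
        rw [div_mul_div_comm, hPP, sq]]
    norm_num
    abel
  · have hI : Complex.normSq (Complex.I ^ (k : ℕ)) = 1 := by simp
    have hI' : Complex.normSq ((-Complex.I) ^ (k : ℕ)) = 1 := by simp
    rw [nsq_basis, nsq_basis, map_mul, map_mul, hI, hI', map_one, Complex.normSq_ofReal,
      Complex.normSq_ofReal, Complex.normSq_ofReal, hPP,
      show √q * h / √P * (√q * h / √P) = q * h ^ 2 / P by
        rw [div_mul_div_comm, hPP, mul_mul_mul_comm, hqq, sq],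
      show √q * g * (√q * g) = q * g ^ 2 by rw [mul_mul_mul_comm, hqq, sq], mixValue]
    field_simp
    ring

/-- A linear map under which product states have overlap at most `1 / 2` with a ket `ξ` maps
`mixState` to an operator of overlap at most `mixValue`. -/
lemma quad_map_mixState_le {I : Type} [Fintype I] (u v : QubitBasis) {P q : ℝ} (hP : 0 < P)
    (hq : 0 ≤ q) (g h : ℝ) (Λ : Op (Fin 2 × Fin 2) →ₗ[ℂ] Op I) (ξ : Ket I)
    (hΛ : ∀ x y : Ket (Fin 2), 0 ≤ quad ξ (Λ (proj (tens x y))) ∧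
      quad ξ (Λ (proj (tens x y))) ≤ (2 : ℝ)⁻¹ * (nsq x * nsq y)) :
    quad ξ (Λ (mixState u v P q g h)) ≤ mixValue P q g h := by
  obtain ⟨x, y, hxy, hn⟩ := exists_separable u v hP hq g h
  have h1 := congrArg (fun X => quad ξ (Λ X)) hxy
  beta_reduce at h1
  rw [Λ.map_add, Λ.map_smul, Λ.map_smul, map_sum, quad_add, quad_smul, quad_smul, quad_sum] at h1
  -- The term added to reach separability contributes nonnegatively and is dropped.
  have h2 : 0 ≤ (q * g * h) ^ 2 / P * quad ξ (Λ (proj (prodKet u v 1 0))) :=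
    mul_nonneg (by positivity) (hΛ (basisKet u 1) (basisKet v 0)).1
  have h3 : ∑ k, quad ξ (Λ (proj (tens (x k) (y k)))) ≤ ∑ _k : Fin 4, mixValue P q g h :=
    Finset.sum_le_sum fun k _ => (hΛ _ _).2.trans_eq (hn k)
  simp only [Finset.sum_const, Finset.card_univ, Fintype.card_fin, nsmul_eq_mul] at h3
  push_cast at h3
  linarith

lemma Locc.quad_run_mixState_le (u v : QubitBasis) {P q : ℝ} (hP : 0 < P) (hq : 0 ≤ q) (g h : ℝ)
    (L : Locc 2 2 2 2) {ξ : Ket (Fin 2 × Fin 2)} (hξ : IsMaxEntangled ξ) :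
    quad ξ (L.run (mixState u v P q g h)) ≤ mixValue P q g h :=
  quad_map_mixState_le u v hP hq g h L.runLin ξ fun x y => by
    have h := L.quad_run_tens hξ x y
    rwa [Nat.cast_ofNat] at h

/-! ### The filter that attains the bound. -/

/-- Alice's filter `diag(a, 1)`, `diag(b, 0)`, followed by the basis change from `u` to `u'`. -/
noncomputable def filterKraus (u' u : QubitBasis) (a b : ℝ) (i : Fin 2) : Op (Fin 2) :=
  changeBasis u' u (Matrix.diagonal (![![(a : ℂ), 1], ![(b : ℂ), 0]] i))

lemma sum_filterKraus (u' u : QubitBasis) {a b : ℝ} (hab : a ^ 2 + b ^ 2 = 1) :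
    ∑ i, (filterKraus u' u a b i).conjTranspose * filterKraus u' u a b i = 1 := by
  have hab' : (a : ℂ) * a + b * b = 1 := by
    rw [← sq, ← sq]; exact_mod_cast hab
  have h : (1 : Op (Fin 2)) = u.1 * 1 * u.1.conjTranspose := by
    rw [Matrix.mul_one, mul_conjTranspose_self_unitary]
  simp only [filterKraus, changeBasis_conjTranspose_mul]
  rw [Fin.sum_univ_two, ← Matrix.add_mul, ← Matrix.mul_add, h]
  congr 2
  ext i j
  fin_cases i <;> fin_cases j <;> simp [Matrix.diagonal_conjTranspose, hab']

/-- Bob's replacement of his state by `v_0`. -/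
noncomputable def resetKraus (v : QubitBasis) (i : Fin 2) : Op (Fin 2) :=
  changeBasis v v (Matrix.single 0 i 1)

lemma sum_resetKraus (v : QubitBasis) :
    ∑ i, (resetKraus v i).conjTranspose * resetKraus v i = 1 := by
  have h : (1 : Op (Fin 2)) = v.1 * 1 * v.1.conjTranspose := by
    rw [Matrix.mul_one, mul_conjTranspose_self_unitary]
  simp only [resetKraus, changeBasis_conjTranspose_mul]
  rw [Fin.sum_univ_two, ← Matrix.add_mul, ← Matrix.mul_add, h]
  congr 2
  ext i j
  fin_cases i <;> fin_cases j <;> simp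

/-- The protocol in which Alice filters and, if the filter fails, Bob resets his qubit. -/
noncomputable def filterProtocol (u' u v : QubitBasis) (a b : ℝ) (hab : a ^ 2 + b ^ 2 = 1) :
    Locc 2 2 2 2 :=
  .alice (m := 2) (fun _ => 2) (filterKraus u' u a b) (sum_filterKraus u' u hab)
    ![.done, .bob (m := 2) (fun _ => 2) (resetKraus v) (sum_resetKraus v) fun _ => .done]

lemma mul_add_proj_mul {I I' : Type} [Fintype I] (M : Matrix I' I ℂ) (c d : ℂ) (x y : Ket I) :
    M * (c • proj x + d • proj y) * M.conjTranspose =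
      c • proj (M.mulVec x) + d • proj (M.mulVec y) := by
  simp only [Matrix.mul_add, Matrix.add_mul, Matrix.mul_smul, Matrix.smul_mul, mul_proj_mul]

/-- Success leaves the noise term orthogonal to the Bell ket and gives q(ag + h)²/2. Failure has
weight b²(P + qg²), all of it moved by Bob to u'_0 v_0, whose overlap is 1/2. -/
lemma quad_filterProtocol (u' u v : QubitBasis) {a b : ℝ} (hab : a ^ 2 + b ^ 2 = 1)
    (P q g h : ℝ) :
    quad (bellKet u' v) ((filterProtocol u' u v a b hab).run (mixState u v P q g h)) =
      1 / 2 * (q * (g ^ 2 + h ^ 2 + 2 * a * g * h) + P * (1 - a ^ 2)) := by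
  have hA : ∀ i j k, (filterKraus u' u a b k ⊗ₖ (1 : Op (Fin 2))).mulVec (prodKet u v i j) =
      (![![(a : ℂ), 1], ![(b : ℂ), 0]] k i) • prodKet u' v i j := by
    intro i j k
    rw [prodKet_eq_tens, kronecker_mulVec_tens, filterKraus, changeBasis_mulVec, Matrix.one_mulVec]
    ext r
    fin_cases i <;> simp [tens, prodKet, basisKet, Matrix.diagonal, mul_assoc]
  have hB : ∀ i j k, ((1 : Op (Fin 2)) ⊗ₖ resetKraus v k).mulVec (prodKet u' v i j) =
      (if k = j then 1 else 0 : ℂ) • prodKet u' v i 0 := by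
    intro i j k
    rw [prodKet_eq_tens, kronecker_mulVec_tens, resetKraus, changeBasis_mulVec, Matrix.one_mulVec]
    ext r
    by_cases hkj : k = j <;> simp [tens, prodKet, basisKet, Matrix.single_apply, hkj]
  have hbell : ∀ {x : Ket (Fin 2 × Fin 2)} (a b c : ℂ),
      x = a • prodKet u' v 0 0 + b • prodKet u' v 1 1 + c • prodKet u' v 0 1 →
      quad (bellKet u' v) (proj x) = Complex.normSq (a + b) / 2 := fun a b c hx => by
    rw [hx, quad_proj, normSq_bellKet_dotProduct]
  simp only [filterProtocol, Locc.run, Fin.sum_univ_two, Matrix.cons_val_zero, Matrix.cons_val_one,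
    mixState, mul_add_proj_mul, Matrix.mulVec_add, Matrix.mulVec_smul, hA, hB, quad_add, quad_smul]
  rw [hbell 0 0 a (by simp), hbell (g * a) h 0 (by simp [mul_smul]), hbell 0 0 0 (by simp),
    hbell (g * b) 0 0 (by simp [mul_smul]), hbell b 0 0 (by simp), hbell 0 0 0 (by simp)]
  simp only [add_zero, map_zero, ← Complex.ofReal_mul, ← Complex.ofReal_add,
    Complex.normSq_ofReal]
  have hb : b ^ 2 = 1 - a ^ 2 := by linarith
  linear_combination (1 / 2 * q * g ^ 2 + 1 / 2 * P) * hb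

/-- The filter is optimal when its success amplitude `q g h / P` is at most one. -/
lemma exists_quad_run_eq_mixValue (u' u v : QubitBasis) {P q g h : ℝ} (hP : 0 < P)
    (hle : (q * g * h) ^ 2 ≤ P ^ 2) :
    ∃ L : Locc 2 2 2 2, quad (bellKet u' v) (L.run (mixState u v P q g h)) =
      mixValue P q g h := by
  have ha : (q * g * h / P) ^ 2 ≤ 1 := by
    rw [div_pow]; exact div_le_one_of_le₀ hle (sq_nonneg _)
  -- This a maximizes the concave quadratic 2qgh·a - P·a² left by `quad_filterProtocol`.
  refine ⟨filterProtocol u' u v (q * g * h / P) (√(1 - (q * g * h / P) ^ 2))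
    (by rw [Real.sq_sqrt (by linarith)]; ring), ?_⟩
  rw [quad_filterProtocol, mixValue]
  field_simp
  ring

lemma ofef_mixState (u v : QubitBasis) {P q g h : ℝ} (hP : 0 < P) (hq : 0 ≤ q)
    (hle : (q * g * h) ^ 2 ≤ P ^ 2) :
    IsGreatest (ofefValues (mixState u v P q g h)) (ofef (mixState u v P q g h)) ∧
      ofef (mixState u v P q g h) = mixValue P q g h := by
  have hgr : IsGreatest (ofefValues (mixState u v P q g h)) (mixValue P q g h) := by
    obtain ⟨L, hL⟩ := exists_quad_run_eq_mixValue u u v hP hle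
    have hB : ∀ L : Locc 2 2 2 2, ∀ ξ, IsMaxEntangled ξ →
        quad ξ (L.run (mixState u v P q g h)) ≤ mixValue P q g h := fun L ξ hξ =>
      L.quad_run_mixState_le u v hP hq g h hξ
    refine ⟨⟨L, ((isMaxEntangled_bellKet u v).fef_eq (hB L) hL).symm⟩, ?_⟩
    rintro r ⟨L', rfl⟩
    exact (isMaxEntangled_bellKet u v).fef_le (hB L')
  have h : ofef (mixState u v P q g h) = mixValue P q g h := hgr.csSup_eq
  exact ⟨h ▸ hgr, h⟩

/-! ### The joint state and the outcomes of the node. -/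

/-- `jointState · σ` as a linear map. -/
def jointLin (σ : Op (Fin 2 × Fin 2)) :
    Op (Fin 2 × Fin 2) →ₗ[ℂ] Op (Fin 2 × Fin (2 * 2) × Fin 2) where
  toFun ρ := jointState ρ σ
  map_add' X Y := by ext; simp [jointState, add_mul]
  map_smul' c X := by ext; simp [jointState, mul_assoc]

/-- `collapse φ` as a linear map. -/
noncomputable def collapseLin (φ : Ket (Fin 2 × Fin 2)) :
    Op (Fin 2 × Fin (2 * 2) × Fin 2) →ₗ[ℂ] Op (Fin 2 × Fin 2) where
  toFun := collapse φ
  map_add' X Y := by ext; simp [collapse, mul_add, add_mul, Finset.sum_add_distrib]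
  map_smul' c X := by
    ext
    simp only [collapse, Matrix.of_apply, Matrix.smul_apply, smul_eq_mul, RingHom.id_apply,
      Finset.mul_sum]
    exact Finset.sum_congr rfl fun _ _ => Finset.sum_congr rfl fun _ _ => by ring

/-- The state of the node and Bob if the node's first qubit is in the state `y`. -/
def nodeBobKet (y : Ket (Fin 2)) (ψ : Ket (Fin 2 × Fin 2)) : Ket (Fin (2 * 2) × Fin 2) :=
  fun r => y (finProdFinEquiv.symm r.1).1 * ψ ((finProdFinEquiv.symm r.1).2, r.2)

lemma jointState_proj_tens (x y : Ket (Fin 2)) (ψ : Ket (Fin 2 × Fin 2)) :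
    jointState (proj (tens x y)) (proj ψ) = proj (tens x (nodeBobKet y ψ)) := by
  ext q r
  simp only [jointState, proj, tens, nodeBobKet, Matrix.submatrix_apply,
    Matrix.kroneckerMap_apply, Matrix.vecMulVec_apply, Pi.star_apply, star_mul']
  ring

lemma nsq_nodeBobKet (y : Ket (Fin 2)) (ψ : Ket (Fin 2 × Fin 2)) :
    nsq (nodeBobKet y ψ) = nsq y * nsq ψ := by
  simp only [nsq, nodeBobKet, Fintype.sum_prod_type, map_mul]
  rw [Equiv.sum_comp finProdFinEquiv.symm (fun k : Fin 2 × Fin 2 =>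
    ∑ b, Complex.normSq (y k.1) * Complex.normSq (ψ (k.2, b)))]
  simp only [Fintype.sum_prod_type]
  rw [Finset.sum_mul]
  simp only [Finset.mul_sum]

/-- Attaching the normalized `ψ` turns x ⊗ y into x ⊗ (y ⊗ ψ), still product between Alice and the
rest and of the same norm. Hence the separable majorant of the noisy segment bounds three-party
protocols too. -/
lemma Locc3.quad_run_jointState_le (u v : QubitBasis) {P q : ℝ} (hP : 0 < P) (hq : 0 ≤ q)
    (g h : ℝ) {ψ : Ket (Fin 2 × Fin 2)} (hψ : nsq ψ = 1) (L : Locc3 2 2 2 (2 * 2) 2)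
    {ξ : Ket (Fin 2 × Fin 2)} (hξ : IsMaxEntangled ξ) :
    quad ξ (L.run (jointState (mixState u v P q g h) (proj ψ))) ≤ mixValue P q g h :=
  quad_map_mixState_le u v hP hq g h (L.runLin ∘ₗ jointLin (proj ψ)) ξ fun x y => by
    have h := L.quad_run_tens hξ x (nodeBobKet y ψ)
    rw [← jointState_proj_tens, nsq_nodeBobKet, hψ, mul_one, Nat.cast_ofNat] at h
    exact h

/-- The unnormalized ket of Alice and Bob after the outcome `φ` of the node. -/
noncomputable def contract (φ ξ ψ : Ket (Fin 2 × Fin 2)) : Ket (Fin 2 × Fin 2) :=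
  fun x => ∑ k, ∑ l, star (φ (k, l)) * (ξ (x.1, k) * ψ (l, x.2))

lemma collapse_jointState_proj (φ ξ ψ : Ket (Fin 2 × Fin 2)) :
    collapse φ (jointState (proj ξ) (proj ψ)) = proj (contract φ ξ ψ) := by
  ext x y
  have h : ∀ x : Fin 2 × Fin 2, contract φ ξ ψ x = ∑ k : Fin (2 * 2),
      star (φ (finProdFinEquiv.symm k)) * (ξ (x.1, (finProdFinEquiv.symm k).1) *
        ψ ((finProdFinEquiv.symm k).2, x.2)) := by
    intro x
    rw [Equiv.sum_comp finProdFinEquiv.symm (fun k : Fin 2 × Fin 2 =>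
      star (φ k) * (ξ (x.1, k.1) * ψ (k.2, x.2))), Fintype.sum_prod_type]
    rfl
  have hr : proj (contract φ ξ ψ) x y = contract φ ξ ψ x * star (contract φ ξ ψ y) := rfl
  rw [hr, h, h, star_sum, Finset.sum_mul_sum]
  simp only [collapse, jointState, proj, Matrix.of_apply, Matrix.submatrix_apply,
    Matrix.kroneckerMap_apply, Matrix.vecMulVec_apply, Pi.star_apply, star_mul', star_star]
  exact Finset.sum_congr rfl fun _ _ => Finset.sum_congr rfl fun _ _ => by ring

lemma contract_prodKet (u v w z : QubitBasis) (i j k l m n : Fin 2) :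
    contract (prodKet v w i j) (prodKet u v k l) (prodKet w z m n) =
      ((if i = l then 1 else 0 : ℂ) * (if j = m then 1 else 0)) • prodKet u z k n := by
  rw [← basisKet_dotProduct v, ← basisKet_dotProduct w]
  ext x
  simp only [contract, prodKet, dotProduct, basisKet, Pi.smul_apply, smul_eq_mul, Pi.star_apply,
    star_mul']
  rw [Finset.sum_mul_sum, Finset.sum_mul]
  refine Finset.sum_congr rfl fun _ _ => ?_
  rw [Finset.sum_mul]
  exact Finset.sum_congr rfl fun _ _ => by ring

section Contract

variable (φ φ' ξ ξ' ψ ψ' : Ket (Fin 2 × Fin 2)) (c : ℂ)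

lemma contract_add_left : contract (φ + φ') ξ ψ = contract φ ξ ψ + contract φ' ξ ψ := by
  ext; simp [contract]; ring

lemma contract_add_middle : contract φ (ξ + ξ') ψ = contract φ ξ ψ + contract φ ξ' ψ := by
  ext; simp [contract]; ring

lemma contract_add_right : contract φ ξ (ψ + ψ') = contract φ ξ ψ + contract φ ξ ψ' := by
  ext; simp [contract]; ring

lemma contract_smul_left : contract (c • φ) ξ ψ = star c • contract φ ξ ψ := by
  ext; simp [contract]; ring

lemma contract_smul_middle : contract φ (c • ξ) ψ = c • contract φ ξ ψ := by
  ext; simp [contract]; ring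

lemma contract_smul_right : contract φ ξ (c • ψ) = c • contract φ ξ ψ := by
  ext; simp [contract]; ring

end Contract

/-- The state of Alice and Bob after an outcome `s₀ |v_0 w_0⟩ + s₁ |v_1 w_1⟩` of the node. -/
lemma collapse_schmidt (u v w z : QubitBasis) (p δ α s₀ s₁ : ℝ) :
    collapse ((s₀ : ℂ) • prodKet v w 0 0 + (s₁ : ℂ) • prodKet v w 1 1)
      (jointState (noisyState u v p δ) (proj (schmidtKet w z α))) =
      mixState u z (p * (s₁ * √(1 - α)) ^ 2) (1 - p) (s₀ * √δ * √α) (s₁ * √(1 - δ) * √(1 - α)) := by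
  set φ : Ket (Fin 2 × Fin 2) := (s₀ : ℂ) • prodKet v w 0 0 + (s₁ : ℂ) • prodKet v w 1 1 with hφ
  have h1 : contract φ (prodKet u v 0 1) (schmidtKet w z α) =
      ((s₁ * √(1 - α) : ℝ) : ℂ) • prodKet u z 0 1 := by
    simp only [hφ, schmidtKet, contract_add_left, contract_add_right, contract_smul_left,
      contract_smul_right, contract_prodKet]
    simp only [Fin.isValue, reduceIte, one_ne_zero, zero_ne_one, mul_zero, mul_one,
      zero_smul, one_smul, smul_zero, add_zero, zero_add, Complex.star_def, Complex.conj_ofReal,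
      smul_smul, Complex.ofReal_mul]
    congr 1; ring
  have h2 : contract φ (schmidtKet u v δ) (schmidtKet w z α) =
      ((s₀ * √δ * √α : ℝ) : ℂ) • prodKet u z 0 0 +
        ((s₁ * √(1 - δ) * √(1 - α) : ℝ) : ℂ) • prodKet u z 1 1 := by
    simp only [hφ, schmidtKet, contract_add_left, contract_add_right, contract_smul_left,
      contract_smul_right, contract_add_middle, contract_smul_middle, contract_prodKet]
    simp only [Fin.isValue, reduceIte, one_ne_zero, zero_ne_one, mul_zero, mul_one,
      zero_smul, one_smul, smul_zero, add_zero, zero_add, Complex.star_def, Complex.conj_ofReal,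
      smul_smul, Complex.ofReal_mul]
    congr 2 <;> ring
  change collapseLin φ (jointLin _ _) = _
  rw [noisyState, map_add, map_add, map_smul, map_smul, map_smul, map_smul]
  change (p : ℂ) • collapse φ (jointState (proj _) (proj _)) +
    ((1 - p : ℝ) : ℂ) • collapse φ (jointState (proj _) (proj _)) = _
  rw [collapse_jointState_proj, collapse_jointState_proj, h1, h2, proj_smul, smul_smul, mixState,
    Complex.normSq_ofReal, ← Complex.ofReal_mul, ← sq]

/-- The qubit basis with the two vectors exchanged. -/
def swapBasis (u : QubitBasis) : QubitBasis :=
  u * ⟨!![0, 1; 1, 0], by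
    rw [Matrix.mem_unitaryGroup_iff]
    ext i j
    fin_cases i <;> fin_cases j <;> simp [Matrix.mul_apply, Matrix.star_apply]⟩

lemma swapBasis_apply_zero (u : QubitBasis) (a : Fin 2) : (swapBasis u).1 a 0 = u.1 a 1 := by
  simp [swapBasis, Matrix.mul_apply]

lemma swapBasis_apply_one (u : QubitBasis) (a : Fin 2) : (swapBasis u).1 a 1 = u.1 a 0 := by
  simp [swapBasis, Matrix.mul_apply]

lemma prodKet_swapBasis_zero (v w : QubitBasis) (i : Fin 2) :
    prodKet v (swapBasis w) i 0 = prodKet v w i 1 := by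
  ext x
  rw [prodKet, swapBasis_apply_zero, prodKet]

lemma prodKet_swapBasis_one (v w : QubitBasis) (i : Fin 2) :
    prodKet v (swapBasis w) i 1 = prodKet v w i 0 := by
  ext x
  rw [prodKet, swapBasis_apply_one, prodKet]

lemma bellKet_swapBasis (u z : QubitBasis) :
    bellKet (swapBasis u) (swapBasis z) = bellKet u z := by
  ext x
  simp [bellKet, prodKet, swapBasis_apply_zero, swapBasis_apply_one]
  ring

lemma schmidtKet_swapBasis (w z : QubitBasis) (α : ℝ) :
    schmidtKet (swapBasis w) (swapBasis z) (1 - α) = schmidtKet w z α := by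
  ext x
  simp [schmidtKet, prodKet, swapBasis_apply_zero, swapBasis_apply_one]
  ring

/-! ### Optimal filtering after each outcome. -/

/-- The contribution to the fully entangled fraction of the outcome
`s₀ |v_0 w_0⟩ + s₁ |v_1 w_1⟩` of the node, where `t = s₀ ^ 2`. -/
noncomputable def outcomeValue (p δ α t : ℝ) : ℝ :=
  1 / 2 * (p * ((1 - t) * (1 - α)) + (1 - p) * (t * δ * α + (1 - t) * (1 - δ) * (1 - α)) +
    α * t * (δ * (1 - δ) * (1 - p) ^ 2) / p)

/-- What is needed of the unnormalized state `X` of Alice and Bob after an outcome that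
contributes `r` to the optimal fully entangled fraction: a filter reaches `r` as the overlap
with the fixed ket `bellKet u z`. -/
structure IsFilterable (u z : QubitBasis) (X : Op (Fin 2 × Fin 2)) (r : ℝ) : Prop where
  trace_pos : 0 < X.trace.re
  isGreatest : ∀ c : ℝ, 0 < c → IsGreatest (ofefValues ((c : ℂ) • X)) (ofef ((c : ℂ) • X))
  ofef_eq : ∀ c : ℝ, 0 < c → ofef ((c : ℂ) • X) = c * r
  exists_locc : ∃ L : Locc 2 2 2 2, quad (bellKet u z) (L.run X) = r

lemma IsFilterable.of_swapBasis {u z : QubitBasis} {X : Op (Fin 2 × Fin 2)} {r : ℝ}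
    (h : IsFilterable (swapBasis u) (swapBasis z) X r) : IsFilterable u z X r :=
  ⟨h.trace_pos, h.isGreatest, h.ofef_eq, bellKet_swapBasis u z ▸ h.exists_locc⟩

/-- The family, its value and the filter condition are homogeneous in (P, q), so normalizing changes
nothing essential. The free basis `u'` lets Alice choose the target Bell ket. -/
lemma isFilterable_mixState (u u' z : QubitBasis) {P q g h : ℝ} (hP : 0 < P) (hq : 0 ≤ q)
    (hle : (q * g * h) ^ 2 ≤ P ^ 2) :
    IsFilterable u' z (mixState u z P q g h) (mixValue P q g h) := by
  have key : ∀ c : ℝ, 0 < c → IsGreatest (ofefValues ((c : ℂ) • mixState u z P q g h))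
      (ofef ((c : ℂ) • mixState u z P q g h)) ∧
      ofef ((c : ℂ) • mixState u z P q g h) = c * mixValue P q g h := by
    intro c hc
    rw [smul_mixState, ← mixValue_mul hc.ne']
    refine ofef_mixState u z (mul_pos hc hP) (mul_nonneg hc.le hq) ?_
    calc (c * q * g * h) ^ 2 = c ^ 2 * (q * g * h) ^ 2 := by ring
      _ ≤ c ^ 2 * P ^ 2 := by gcongr
      _ = (c * P) ^ 2 := by ring
  refine ⟨?_, fun c hc => (key c hc).1, fun c hc => (key c hc).2,
    exists_quad_run_eq_mixValue u' u z hP hle⟩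
  rw [trace_mixState]
  positivity

/-- For the parameters of `collapse_schmidt` a factor s₁²(1-α) cancels: (qgh)²/P becomes α s₀² D/p,
and (qgh)² ≤ P² becomes `hle`. -/
lemma isFilterable_collapse_schmidt (u u' v w z : QubitBasis) {p δ α s₀ s₁ : ℝ}
    (hp : 0 < p) (hp1 : p ≤ 1) (hδ0 : 0 ≤ δ) (hδ1 : δ ≤ 1) (hα0 : 0 ≤ α) (hα1 : α < 1)
    (hs : s₀ ^ 2 + s₁ ^ 2 = 1) (hs₁ : s₁ ≠ 0)
    (hle : α * s₀ ^ 2 * δ * (1 - δ) * (1 - p) ^ 2 ≤ (1 - α) * (1 - s₀ ^ 2) * p ^ 2) :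
    IsFilterable u' z (collapse ((s₀ : ℂ) • prodKet v w 0 0 + (s₁ : ℂ) • prodKet v w 1 1)
      (jointState (noisyState u v p δ) (proj (schmidtKet w z α)))) (outcomeValue p δ α (s₀ ^ 2)) := by
  have hα : 0 < 1 - α := by linarith
  have hs₁' : 0 < s₁ ^ 2 := by positivity
  have e1 : √α ^ 2 = α := Real.sq_sqrt hα0
  have e2 : √(1 - α) ^ 2 = 1 - α := Real.sq_sqrt hα.le
  have e3 : √δ ^ 2 = δ := Real.sq_sqrt hδ0
  have e4 : √(1 - δ) ^ 2 = 1 - δ := Real.sq_sqrt (by linarith)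
  have hs' : s₁ ^ 2 = 1 - s₀ ^ 2 := by linarith
  have hsq : ((1 - p) * (s₀ * √δ * √α) * (s₁ * √(1 - δ) * √(1 - α))) ^ 2 =
      s₁ ^ 2 * (1 - α) * (α * s₀ ^ 2 * δ * (1 - δ) * (1 - p) ^ 2) := by
    simp only [mul_pow, e1, e2, e3, e4]; ring
  have hval : mixValue (p * (s₁ * √(1 - α)) ^ 2) (1 - p) (s₀ * √δ * √α)
      (s₁ * √(1 - δ) * √(1 - α)) = outcomeValue p δ α (s₀ ^ 2) := by
    rw [mixValue, hsq]
    simp only [mul_pow, e1, e2, e3, e4]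
    rw [outcomeValue, ← hs']
    field_simp
  rw [collapse_schmidt, ← hval]
  refine isFilterable_mixState u u' z (by rw [mul_pow, e2]; positivity) (by linarith) ?_
  rw [hsq, mul_pow, mul_pow, e2]
  calc _ ≤ s₁ ^ 2 * (1 - α) * ((1 - α) * (1 - s₀ ^ 2) * p ^ 2) := by gcongr
    _ = _ := by rw [← hs']; ring

lemma isFilterable_collapse_nodeKet (u v w z : QubitBasis) {p δ α β : ℝ}
    (hp : 0 < p) (hp1 : p ≤ 1) (hδ0 : 0 ≤ δ) (hδ1 : δ ≤ 1) (hα0 : 0 < α) (hα1 : α < 1)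
    (hβ0 : 0 < β) (hβ1 : β < 1) (hadm : Admissible p δ α β) (i : Fin 4) :
    IsFilterable u z (collapse (nodeKet v w β i)
      (jointState (noisyState u v p δ) (proj (schmidtKet w z α))))
      (![outcomeValue p δ α β, outcomeValue p δ α (1 - β), outcomeValue p δ (1 - α) β,
        outcomeValue p δ (1 - α) (1 - β)] i) := by
  obtain ⟨h1, h2, h3, h4⟩ := hadm
  have hβ : 0 < 1 - β := by linarith
  have e1 : √β ^ 2 = β := Real.sq_sqrt hβ0.le
  have e2 : √(1 - β) ^ 2 = 1 - β := Real.sq_sqrt hβ.le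
  have n1 : √β ≠ 0 := (Real.sqrt_pos.2 hβ0).ne'
  have n2 : √(1 - β) ≠ 0 := (Real.sqrt_pos.2 hβ).ne'
  fin_cases i
  · have h := isFilterable_collapse_schmidt u u v w z (s₀ := √β) (s₁ := √(1 - β)) hp hp1 hδ0 hδ1
      hα0.le hα1 (by rw [e1, e2]; ring) n2 (by rw [e1]; exact h1)
    rw [e1] at h
    exact h
  -- The sign of s₁ passes to the filter amplitude a, which thereby corrects the relative phase and
  -- keeps the same Bell ket.
  · have h := isFilterable_collapse_schmidt u u v w z (s₀ := √(1 - β)) (s₁ := -√β) hp hp1 hδ0 hδ1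
      hα0.le hα1 (by rw [neg_sq, e1, e2]; ring) (neg_ne_zero.2 n1)
      (by rw [e2]; linarith)
    rw [e2, Complex.ofReal_neg, neg_smul, ← sub_eq_add_neg] at h
    exact h
  -- Exchanging the vectors of `w` and `z` reduces this outcome to the first kind with 1-α for α.
  -- Alice's exchange of `u` restores the common Bell ket.
  · have h := isFilterable_collapse_schmidt u (swapBasis u) v (swapBasis w) (swapBasis z)
      (α := 1 - α) (s₀ := √β) (s₁ := √(1 - β)) hp hp1 hδ0 hδ1
      (by linarith) (by linarith) (by rw [e1, e2]; ring) n2 (by rw [e1]; linarith)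
    rw [e1, schmidtKet_swapBasis, prodKet_swapBasis_zero, prodKet_swapBasis_one] at h
    exact h.of_swapBasis
  · have h := isFilterable_collapse_schmidt u (swapBasis u) v (swapBasis w) (swapBasis z)
      (α := 1 - α) (s₀ := √(1 - β)) (s₁ := -√β) hp hp1 hδ0 hδ1
      (by linarith) (by linarith) (by rw [neg_sq, e1, e2]; ring) (neg_ne_zero.2 n1)
      (by rw [e2]; linarith)
    rw [e2, schmidtKet_swapBasis, prodKet_swapBasis_zero, prodKet_swapBasis_one,
      Complex.ofReal_neg, neg_smul, ← sub_eq_add_neg] at h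
    exact h.of_swapBasis

/-! ### The node measurement as a three-party protocol; total values. -/

lemma nodeKet_dotProduct (v w : QubitBasis) {β : ℝ} (hβ0 : 0 ≤ β) (hβ1 : β ≤ 1) (i j : Fin 4) :
    star (nodeKet v w β i) ⬝ᵥ nodeKet v w β j = if i = j then 1 else 0 := by
  have e1 : ((√β : ℝ) : ℂ) * ((√β : ℝ) : ℂ) = β := by
    rw [← Complex.ofReal_mul, Real.mul_self_sqrt hβ0]
  have e2 : ((√(1 - β) : ℝ) : ℂ) * ((√(1 - β) : ℝ) : ℂ) = 1 - β := by
    rw [← Complex.ofReal_mul, Real.mul_self_sqrt (by linarith)]; simp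
  fin_cases i <;> fin_cases j <;>
    simp [nodeKet, prodKet_dotProduct, add_dotProduct, dotProduct_add, sub_dotProduct,
      dotProduct_sub, e1, e2, mul_comm]

/-- The node's measurement of an orthonormal basis, as a Kraus family with trivial output. -/
def braKraus (φ : Fin 4 → Ket (Fin 2 × Fin 2)) (i : Fin 4) : Matrix (Fin 1) (Fin (2 * 2)) ℂ :=
  Matrix.of fun _ k => star (φ i (finProdFinEquiv.symm k))

/-- Orthonormality says that a square matrix has a right inverse; completeness is the statement that
this is also a left inverse. -/
lemma sum_braKraus {φ : Fin 4 → Ket (Fin 2 × Fin 2)}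
    (hφ : ∀ i j, star (φ i) ⬝ᵥ φ j = if i = j then 1 else 0) :
    ∑ i, (braKraus φ i).conjTranspose * braKraus φ i = 1 := by
  let M : Matrix (Fin 4) (Fin (2 * 2)) ℂ := Matrix.of fun i k => star (φ i (finProdFinEquiv.symm k))
  have hM : M * M.conjTranspose = 1 := by
    ext i j
    rw [Matrix.one_apply, ← hφ i j, Matrix.mul_apply, dotProduct,
      ← Equiv.sum_comp finProdFinEquiv.symm]
    simp [M]
  have hM' : M.conjTranspose * M = 1 := (Matrix.mul_eq_one_comm_of_equiv (finCongr rfl)).1 hM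
  rw [← hM']
  ext k l
  simp [Matrix.sum_apply, Matrix.mul_apply, braKraus, M]

lemma traceNode_braKraus (φ : Fin 4 → Ket (Fin 2 × Fin 2)) (i : Fin 4)
    (η : Op (Fin 2 × Fin (2 * 2) × Fin 2)) :
    traceNode (((1 : Op (Fin 2)) ⊗ₖ (braKraus φ i ⊗ₖ (1 : Op (Fin 2)))) * η *
      ((1 : Op (Fin 2)) ⊗ₖ (braKraus φ i ⊗ₖ (1 : Op (Fin 2)))).conjTranspose) =
      collapse (φ i) η := by
  ext q r
  simp only [traceNode, braKraus, collapse, Matrix.of_apply, Matrix.mul_apply,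
    Matrix.kroneckerMap_apply, Fintype.sum_prod_type, Matrix.one_apply,
    Matrix.conjTranspose_apply, mul_ite, ite_mul, one_mul, mul_one, mul_zero, zero_mul,
    Finset.sum_ite_eq, Finset.mem_univ, if_true, apply_ite star, star_zero, Finset.sum_mul,
    Finset.sum_ite_irrel, Finset.sum_const_zero, star_star, Finset.univ_unique,
    Finset.sum_singleton]
  exact Finset.sum_comm

/-- A protocol that starts with the node measurement is a three-party protocol. -/
lemma exists_locc3_run_eq {φ : Fin 4 → Ket (Fin 2 × Fin 2)}
    (hφ : ∀ i j, star (φ i) ⬝ᵥ φ j = if i = j then 1 else 0) (L : Fin 4 → Locc 2 2 2 2)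
    (η : Op (Fin 2 × Fin (2 * 2) × Fin 2)) :
    ∃ L' : Locc3 2 2 2 (2 * 2) 2, L'.run η = ∑ i, (L i).run (collapse (φ i) η) := by
  refine ⟨.node (m := 4) (fun _ => 1) (braKraus φ) (sum_braKraus hφ) fun i => (L i).toLocc3 1, ?_⟩
  simp only [Locc3.run, Locc.run_toLocc3, traceNode_braKraus]

/-- The outcome probabilities sum to 1, and so do the weights αβ, α(1-β), (1-α)β, (1-α)(1-β) of D/p:
the dependence on the resources disappears. -/
lemma sum_outcomeValue {p : ℝ} (hp : 0 < p) (δ α β : ℝ) :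
    ∑ i, ![outcomeValue p δ α β, outcomeValue p δ α (1 - β), outcomeValue p δ (1 - α) β,
      outcomeValue p δ (1 - α) (1 - β)] i = 1 / 2 * (1 + δ * (1 - δ) * (1 - p) ^ 2 / p) := by
  simp only [Fin.sum_univ_four, Matrix.cons_val, outcomeValue]
  field_simp
  ring

lemma nsq_schmidtKet (w z : QubitBasis) {α : ℝ} (hα0 : 0 ≤ α) (hα1 : α ≤ 1) :
    nsq (schmidtKet w z α) = 1 := by
  rw [schmidtKet, nsq_schmidt, Complex.normSq_ofReal, Complex.normSq_ofReal,
    Real.mul_self_sqrt hα0, Real.mul_self_sqrt (by linarith)]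
  ring

lemma mixValue_noisyState {p δ : ℝ} (hδ0 : 0 ≤ δ) (hδ1 : δ ≤ 1) :
    mixValue p (1 - p) (√δ) (√(1 - δ)) = 1 / 2 * (1 + δ * (1 - δ) * (1 - p) ^ 2 / p) := by
  rw [mixValue, mul_pow, mul_pow, Real.sq_sqrt hδ0, Real.sq_sqrt (by linarith)]
  ring

/-! ### The parameter inequalities. -/

/-- The first two inequalities bound the coherence of the noisy state. -/
lemma Admissible.coherence_le {p δ α β : ℝ} (h : Admissible p δ α β) (hα : 1 / 2 ≤ α)
    (hα1 : α < 1) (hβ : 0 < β) (hβ1 : β < 1) : δ * (1 - δ) * (1 - p) ^ 2 ≤ p ^ 2 := by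
  obtain ⟨h1, h2, -, -⟩ := h
  have hp2 : (1 - α) * p ^ 2 ≤ α * p ^ 2 := by gcongr; linarith
  have key : α * (δ * (1 - δ) * (1 - p) ^ 2) ≤ (1 - α) * p ^ 2 := by
    -- Use the inequality whose left side carries the larger of β and 1-β, and divide by it.
    rcases le_total β (1 - β) with hβ' | hβ'
    · refine le_of_mul_le_mul_left ?_ (show 0 < 1 - β by linarith)
      have : (1 - α) * β * p ^ 2 ≤ (1 - α) * (1 - β) * p ^ 2 := by
        gcongr
      linarith
    · refine le_of_mul_le_mul_left ?_ hβ
      have : (1 - α) * (1 - β) * p ^ 2 ≤ (1 - α) * β * p ^ 2 := by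
        gcongr
      linarith
  exact le_of_mul_le_mul_left (key.trans hp2) (by linarith)

lemma Admissible.pos {p δ α β : ℝ} (h : Admissible p δ α β) (hp : 0 ≤ p) (hδ0 : 0 < δ)
    (hδ1 : δ < 1) (hα : 1 / 2 ≤ α) (hα1 : α < 1) (hβ : 0 < β) (hβ1 : β < 1) : 0 < p := by
  rcases hp.eq_or_lt with rfl | hp
  · have h1 := h.coherence_le hα hα1 hβ hβ1
    have h2 : 0 < δ * (1 - δ) := mul_pos hδ0 (by linarith)
    norm_num at h1
    linarith
  · exact hp

/-- `h2` is the first inequality cleared of denominators. `h1` gives αD ≤ (1-α)p², hence the second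
because 1-β ≤ β; the last two follow from these because 1-α ≤ α. -/
lemma admissible_of_le {p δ α β : ℝ} (hp : 0 < p) (hδ0 : 0 ≤ δ) (hδ1 : δ ≤ 1)
    (hα : 1 / 2 ≤ α) (hα1 : α < 1) (hβ : 1 / 2 ≤ β) (hβ1 : β < 1)
    (h1 : α < p ^ 2 / (p ^ 2 + δ * (1 - δ) * (1 - p) ^ 2))
    (h2 : β ≤ (1 - α) * p ^ 2 / ((1 - α) * p ^ 2 + α * δ * (1 - δ) * (1 - p) ^ 2)) :
    Admissible p δ α β := by
  have hα' : 0 < 1 - α := by linarith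
  have hD : 0 ≤ δ * (1 - δ) * (1 - p) ^ 2 := by
    have : 0 ≤ 1 - δ := by linarith
    positivity
  have hαp : 0 < (1 - α) * p ^ 2 := by positivity
  have hαD : 0 ≤ α * (δ * (1 - δ) * (1 - p) ^ 2) := mul_nonneg (by linarith) hD
  rw [lt_div_iff₀ (by positivity)] at h1
  rw [le_div_iff₀ (by linarith)] at h2
  have i1 : α * β * δ * (1 - δ) * (1 - p) ^ 2 ≤ (1 - α) * (1 - β) * p ^ 2 := by linarith
  have i2 : α * (1 - β) * δ * (1 - δ) * (1 - p) ^ 2 ≤ (1 - α) * β * p ^ 2 := by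
    have a1 : (1 - β) * (α * (δ * (1 - δ) * (1 - p) ^ 2)) ≤ (1 - β) * ((1 - α) * p ^ 2) :=
      mul_le_mul_of_nonneg_left (by linarith) (by linarith)
    have a2 : (1 - β) * ((1 - α) * p ^ 2) ≤ β * ((1 - α) * p ^ 2) :=
      mul_le_mul_of_nonneg_right (by linarith) hαp.le
    linarith
  have mono : ∀ t : ℝ, 0 ≤ t → (1 - α) * t ≤ α * t := fun t ht =>
    mul_le_mul_of_nonneg_right (by linarith) ht
  refine ⟨i1, i2, ?_, ?_⟩
  · have a1 := mono (β * (δ * (1 - δ) * (1 - p) ^ 2)) (mul_nonneg (by linarith) hD)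
    have a2 := mono ((1 - β) * p ^ 2) (mul_nonneg (by linarith) (sq_nonneg p))
    linarith
  · have a1 := mono ((1 - β) * (δ * (1 - δ) * (1 - p) ^ 2)) (mul_nonneg (by linarith) hD)
    have a2 := mono (β * p ^ 2) (mul_nonneg (by linarith) (sq_nonneg p))
    linarith

lemma coherence_lt {p δ : ℝ} (hp1 : p ≤ 1) (hδ : 1 / 2 ≤ δ) (hδ1 : δ < 1)
    (h : 1 / 3 < p ∨ (0 < p ∧ 1 / 2 * (1 + √(1 - 4 * p ^ 2 / (1 - p) ^ 2)) < δ)) :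
    δ * (1 - δ) * (1 - p) ^ 2 < p ^ 2 := by
  rcases h with h | ⟨hp, h⟩
  · have h1 : δ * (1 - δ) ≤ 1 / 4 := by nlinarith [sq_nonneg (δ - 1 / 2)]
    have h2 : δ * (1 - δ) * (1 - p) ^ 2 ≤ 1 / 4 * (1 - p) ^ 2 := by gcongr
    nlinarith
  · rcases hp1.eq_or_lt with rfl | hp1
    -- At p = 1 the quotient in the hypothesis is a division by zero, but the claim is just 0 < 1.
    · norm_num
    · have hq : 0 < (1 - p) ^ 2 := by
        have : 0 < 1 - p := by linarith
        positivity
      have h1 : √(1 - 4 * p ^ 2 / (1 - p) ^ 2) < 2 * δ - 1 := by linarith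
      -- Squaring is also valid for a negative radicand, where the root is 0 by convention.
      have h2 := (Real.sqrt_lt' (by linarith [Real.sqrt_nonneg (1 - 4 * p ^ 2 / (1 - p) ^ 2)])).1 h1
      have h3 : 4 * (δ * (1 - δ)) < 4 * p ^ 2 / (1 - p) ^ 2 := by linarith
      rw [lt_div_iff₀ hq] at h3
      linarith

lemma exists_admissible {p δ : ℝ} (hp : 0 < p) (hδ0 : 0 ≤ δ) (hδ1 : δ ≤ 1)
    (h : δ * (1 - δ) * (1 - p) ^ 2 < p ^ 2) :
    ∃ α ∈ Set.Ioo (1 / 2 : ℝ) 1, ∃ β ∈ Set.Ioo (1 / 2 : ℝ) 1, Admissible p δ α β := by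
  have hD : 0 ≤ δ * (1 - δ) * (1 - p) ^ 2 := by
    have : 0 ≤ 1 - δ := by linarith
    positivity
  have hp2 : 0 < p ^ 2 := by positivity
  -- D < p² is what puts the threshold for α above 1/2; α below that threshold in turn puts the one
  -- for β above 1/2.
  obtain ⟨α, hα, hα'⟩ := exists_between
    (show 1 / 2 < p ^ 2 / (p ^ 2 + δ * (1 - δ) * (1 - p) ^ 2) by
      rw [lt_div_iff₀ (by linarith)]; linarith)
  have hα1 : α < 1 := hα'.trans_le (div_le_one_of_le₀ (by linarith) (by linarith))
  have hαp : 0 < (1 - α) * p ^ 2 := mul_pos (by linarith) hp2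
  have hαD : 0 ≤ α * (δ * (1 - δ) * (1 - p) ^ 2) := mul_nonneg (by linarith) hD
  have hαD' : α * (p ^ 2 + δ * (1 - δ) * (1 - p) ^ 2) < p ^ 2 := by
    rwa [lt_div_iff₀ (by linarith)] at hα'
  obtain ⟨β, hβ, hβ'⟩ := exists_between
    (show 1 / 2 < (1 - α) * p ^ 2 / ((1 - α) * p ^ 2 + α * δ * (1 - δ) * (1 - p) ^ 2) by
      rw [lt_div_iff₀ (by linarith)]; linarith)
  have hβ1 : β < 1 := hβ'.trans_le (div_le_one_of_le₀ (by linarith) (by linarith))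
  exact ⟨α, ⟨hα, hα1⟩, β, ⟨hβ, hβ1⟩,
    admissible_of_le hp hδ0 hδ1 hα.le hα1 hβ.le hβ1 hα' hβ'.le⟩

end Repeater

/-- `u` is Alice's basis, `v` and `w` are the bases of the node's qubits in the first and in the
second segment, `z` is Bob's basis. -/
theorem theorem1 (u v w z : QubitBasis) (p δ : ℝ) (hp : p ∈ Set.Icc (0 : ℝ) 1)
    (hδ : δ ∈ Set.Ico (1 / 2 : ℝ) 1) :
    -- under the four inequalities the end-to-end optimum is the optimum of the noisy segment
    (∀ α ∈ Set.Ico (1 / 2 : ℝ) 1, ∀ β ∈ Set.Ico (1 / 2 : ℝ) 1, Admissible p δ α β →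
      let ρ := noisyState u v p δ
      let η := jointState ρ (proj (schmidtKet w z α))
      let φ := nodeKet v w β
      let F : ℝ := 1 / 2 * (1 + δ * (1 - δ) * (1 - p) ^ 2 / p)
      -- the optimal fully entangled fraction of the noisy state
      (IsGreatest (ofefValues ρ) (ofef ρ) ∧ ofef ρ = F) ∧
      -- the average over the outcomes of the node measurement
      (∀ i, 0 < outcomeProb (φ i) η ∧
        IsGreatest (ofefValues (postState (φ i) η)) (ofef (postState (φ i) η))) ∧
      ∑ i, outcomeProb (φ i) η * ofef (postState (φ i) η) = F ∧
      -- the optimum over protocols that start with the node measurement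
      IsGreatest (measuredValues φ η) F ∧
      -- the optimum over all three-party protocols
      IsGreatest (endToEndValues η) F) ∧
    -- a range of parameters in which the four inequalities hold
    (∀ α ∈ Set.Ico (1 / 2 : ℝ) 1, ∀ β ∈ Set.Ico (1 / 2 : ℝ) 1, 0 < p →
      α < p ^ 2 / (p ^ 2 + δ * (1 - δ) * (1 - p) ^ 2) →
      β ≤ (1 - α) * p ^ 2 / ((1 - α) * p ^ 2 + α * δ * (1 - δ) * (1 - p) ^ 2) →
      Admissible p δ α β) ∧
    -- non-maximal resources suffice
    ((1 / 3 < p ∨ (0 < p ∧ 1 / 2 * (1 + √(1 - 4 * p ^ 2 / (1 - p) ^ 2)) < δ)) →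
      ∃ α ∈ Set.Ioo (1 / 2 : ℝ) 1, ∃ β ∈ Set.Ioo (1 / 2 : ℝ) 1, Admissible p δ α β) := by
  obtain ⟨hp0, hp1⟩ := hp
  obtain ⟨hδ, hδ1⟩ := hδ
  have hδ0 : 0 < δ := by linarith
  refine ⟨?_, ?_, ?_⟩
  · rintro α ⟨hα, hα1⟩ β ⟨hβ, hβ1⟩ hadm ρ η φ F
    have hα0 : 0 < α := by linarith
    have hβ0 : 0 < β := by linarith
    have hp : 0 < p := hadm.pos hp0 hδ0 hδ1 hα hα1 hβ0 hβ1
    have hq : 0 ≤ 1 - p := by linarith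
    have hF : mixValue p (1 - p) (√δ) (√(1 - δ)) = F := mixValue_noisyState hδ0.le hδ1.le
    have hout : ∀ i, IsFilterable u z (collapse (φ i) η)
        (![outcomeValue p δ α β, outcomeValue p δ α (1 - β), outcomeValue p δ (1 - α) β,
          outcomeValue p δ (1 - α) (1 - β)] i) :=
      isFilterable_collapse_nodeKet u v w z hp hp1 hδ0.le hδ1.le hα0 hα1 hβ0 hβ1 hadm
    have hpost : ∀ i, postState (φ i) η =
        (((outcomeProb (φ i) η)⁻¹ : ℝ) : ℂ) • collapse (φ i) η := fun i => by
      rw [postState, Complex.ofReal_inv]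
    have hprob : ∀ i, 0 < outcomeProb (φ i) η := fun i => (hout i).trace_pos
    have hsum := sum_outcomeValue hp δ α β
    have hB : ∀ L : Locc3 2 2 2 (2 * 2) 2, ∀ ξ, IsMaxEntangled ξ → quad ξ (L.run η) ≤ F :=
      fun L ξ hξ => (L.quad_run_jointState_le u v hp hq _ _
        (nsq_schmidtKet w z hα0.le hα1.le) hξ).trans_eq hF
    have hbell := isMaxEntangled_bellKet u z
    have hend : ∀ r ∈ endToEndValues η, r ≤ F := by
      rintro r ⟨L, rfl⟩
      exact hbell.fef_le (hB L)
    have hφ := nodeKet_dotProduct v w hβ0.le hβ1.le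
    have hsub : measuredValues φ η ⊆ endToEndValues η := by
      rintro r ⟨L, rfl⟩
      obtain ⟨L', hL'⟩ := exists_locc3_run_eq hφ L η
      exact ⟨L', by rw [hL']⟩
    have hmem : F ∈ measuredValues φ η := by
      choose L hL using fun i => (hout i).exists_locc
      -- The outcome is forgotten at the end, so one Bell ket must serve all four branches: their
      -- overlaps with it sum to F, and the three-party bound shows that no other ket does better.
      refine ⟨L, (hbell.fef_eq ?_ ?_).symm⟩
      · obtain ⟨L', hL'⟩ := exists_locc3_run_eq hφ L η
        exact hL' ▸ hB L'
      · rw [quad_sum]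
        exact (Finset.sum_congr rfl fun i _ => hL i).trans hsum
    have hcoh : ((1 - p) * √δ * √(1 - δ)) ^ 2 ≤ p ^ 2 := by
      rw [mul_pow, mul_pow, Real.sq_sqrt hδ0.le, Real.sq_sqrt (by linarith)]
      linarith [hadm.coherence_le hα hα1 hβ0 hβ1]
    have hρ := ofef_mixState u v hp hq hcoh
    refine ⟨⟨hρ.1, hρ.2.trans hF⟩, fun i => ⟨hprob i, ?_⟩, ?_, ⟨hmem, fun r hr => hend r (hsub hr)⟩,
      ⟨hsub hmem, hend⟩⟩
    · rw [hpost]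
      exact (hout i).isGreatest _ (inv_pos.2 (hprob i))
    · refine Eq.trans (Finset.sum_congr rfl fun i _ => ?_) hsum
      rw [hpost, (hout i).ofef_eq _ (inv_pos.2 (hprob i)), mul_inv_cancel_left₀ (hprob i).ne']
  · rintro α ⟨hα, hα1⟩ β ⟨hβ, hβ1⟩ hp h1 h2
    exact admissible_of_le hp hδ0.le hδ1.le hα hα1 hβ hβ1 h1 h2
  · intro h
    have hp : 0 < p := by
      rcases h with h | h
      · linarith
      · exact h.1
    exact exists_admissible hp hδ0.le hδ1.le (coherence_lt hp1 hδ hδ1 h)
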